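/- Let $T$ be a complete consistent first-order theory, possibly many-sorted, with signature $L$, and let $\mathbb M$ be a big model of $T$: for a cardinal $\kappa>\aleph_0+|L|$, $\mathbb M$ is $\kappa$-saturated and strongly $\kappa$-homogeneous, and all sorts are non-empty. A set of elements is *small* if it has fewer than $\kappa$ elements. $A,B,C,\hat B,\dots$ denote small sets of elements of $\mathbb M$; $AB$ means $A\cup B$; $\operatorname{acl}$ is algebraic closure in $\mathbb M$; a tuple is also used as a name for the set of its entries; $A'\equiv_C A$ means that some automorphism of $\mathbb M$ fixes $C$ pointwise and maps the set $A$ onto $A'$. **Inconsistency pairs and dividing.** $\Xi$ is the set of all pairs $(\phi(\bar x;\bar y),\psi(\bar y_{<k}))$ of formulas without parameters ($k<\omega$, $\bar y_{<k}=\bar y_0\dots\bar y_{k-1}$) such that $\bigwedge_{i<k}\phi(\bar x;\bar y_i)\wedge\psi(\bar y_{<k})$ is inconsistent with $T$. For $(\phi,\psi)\in\Xi$, a formula $\phi(\bar x;\bar b)$ *$(\phi,\psi)$-divides over $C$* if there is a sequence $(\bar b_i)_{i<\omega}$ of realisations of $\operatorname{tp}(\bar b/C)$ with $\models\psi(\bar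 b_{i_0},\dots,\bar b_{i_{k-1}})$ for all $i_0<\dots<i_{k-1}<\omega$. For $\Omega\subseteq\Xi$ write $A\perp^{\Omega}_C B$ if there are no $(\phi,\psi)\in\Omega$, tuple $\bar a$ in $A$ and tuple $\bar b$ in $BC$ such that $\models\phi(\bar a;\bar b)$ and $\phi(\bar x;\bar b)$ $(\phi,\psi)$-divides over $C$. $\Omega$ is *closed under variable substitution* if replacing in a pair of $\Omega$ the variables $\bar x,\bar y,\bar y_0,\dots,\bar y_{k-1}$ by pairwise disjoint tuples $\bar u,\bar v,\bar v_0,\dots,\bar v_{k-1}$, possibly with repetitions within a tuple (the same repetitions in $\bar v$ and in every $\bar v_i$), gives again a pair of $\Omega$. $\Xi_{\mathrm M}$ is the set of those pairs in $\Xi$ that have the form $(\phi(\bar x;u\bar v),\psi((u\bar v)_{<k}))$ with $u$ a single variable and $\psi$ equivalent (modulo $T$) to $\bigwedge_{i<j<k}(u_i\neq u_j\wedge\bar v_i=\bar v_j)$; the tuple $u\bar v$ of variables may have repetitions. $\Omega$ is *transitive* if for all $(\phi(\bar y;\bar x),\psi(\bar x_{<k}))\in\Omega$, all $D\subseteq C$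 and all $\bar a$ with $C\perp^{\Omega}_D\bar a$: if $\phi(\bar y;\bar a)$ $(\phi,\psi)$-divides over $D$, then it $(\phi,\psi)$-divides over $C$. $\Omega$ is *normal* if $(\phi(\bar x,\bar z;\bar y),\psi(\bar y_{<k}))\in\Omega$ implies $(\phi(\bar x;\bar z,\bar y),\;\psi(\bar y_{<k})\wedge\bar z_0=\bar z_1=\dots=\bar z_{k-1})\in\Omega$. **M-dividing and thorn-forking.** $A\perp^{\mathrm M}_C B$ holds iff $\operatorname{acl}(AC')\cap\operatorname{acl}(BC')=\operatorname{acl}C'$ for every $C'$ with $C\subseteq C'\subseteq\operatorname{acl}(BC)$. For a ternary relation $\perp$, $A\perp^{*}_C B$ holds iff for every $\hat B\supseteq B$ there is $A'\equiv_{BC}A$ with $A'\perp_C\hat B$. Thorn-forking independence is defined by: $A\perp^{\text{þ}}_C B$ iff for every $\hat B\supseteq B$ there is $A'\equiv_{BC}A$ with $A'\perp^{\mathrm M}_C\hat B$. **Proposition.** For all small sets $A,B,C$: 1. $A\perp^{\Xi_{\mathrm M}}_C B$ if and only if $\operatorname{acl}(AD)\cap B\subseteq\operatorname{acl}D$ for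 every set $D$ with $C\subseteq D\subseteq BC$. 2. $\Xi_{\mathrm M}$, which is a set of inconsistency pairs closed under variable substitution, is transitive and normal. 3. $A\perp^{\mathrm M}_C B$ implies $A\perp^{\Xi_{\mathrm M}}_C B$. 4. $A\perp^{\text{þ}}_C B\iff A\perp^{\mathrm M*}_C B\iff A\perp^{\Xi_{\mathrm M}*}_C B$. -/

import Mathlib

open Cardinal

universe u w w'

/-! ### Many-sorted first-order logic -/

/-- A many-sorted first-order signature (one-sorted signatures are the case of a single sort).
`dom f` lists the argument sorts of the function symbol `f` (empty for a constant), `cod f` is its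
value sort, and `ar R` lists the argument sorts of the relation symbol `R`. -/
structure SortedLanguage : Type (u + 1) where
  Sorts : Type u
  Fn : Type u
  dom : Fn → List Sorts
  cod : Fn → Sorts
  Rel : Type u
  ar : Rel → List Sorts

namespace SortedLanguage

/-- The number of sorts and symbols of the signature. -/
noncomputable def card (L : SortedLanguage.{u}) : Cardinal.{u} := #L.Sorts + #L.Fn + #L.Rel

/-- A structure with carriers `M s`, one for each sort `s`. -/
class Structure (L : SortedLanguage.{u}) (M : L.Sorts → Type u) where
  funMap : ∀ f : L.Fn, (∀ i : Fin (L.dom f).length, M ((L.dom f).get i)) → M (L.cod f)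
  relMap : ∀ R : L.Rel, (∀ i : Fin (L.ar R).length, M ((L.ar R).get i)) → Prop

/-- Terms in the free variables `a : α`, where the variable `a` has sort `σ a`; the last index is
the sort of the term. -/
inductive Term (L : SortedLanguage.{u}) {α : Type w} (σ : α → L.Sorts) :
    L.Sorts → Type (max u w)
  | var (a : α) : Term L σ (σ a)
  | func (f : L.Fn) (ts : ∀ i : Fin (L.dom f).length, Term L σ ((L.dom f).get i)) :
      Term L σ (L.cod f)

/-- The sorts of the free variables `α` together with the bound variables of a context `Γ`. -/
abbrev ctx {L : SortedLanguage.{u}} {α : Type w} (σ : α → L.Sorts) (Γ : List L.Sorts) :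
    α ⊕ Fin Γ.length → L.Sorts := Sum.elim σ Γ.get

/-- First-order formulas with free variables `α` (of sorts `σ`) and, in addition, de Bruijn
variables of the sorts listed in `Γ`; the quantifier binds the head of the list. -/
inductive BFormula (L : SortedLanguage.{u}) {α : Type w} (σ : α → L.Sorts) :
    List L.Sorts → Type (max u w)
  | falsum {Γ : List L.Sorts} : BFormula L σ Γ
  | equal {Γ : List L.Sorts} {s : L.Sorts} (t₁ t₂ : L.Term (ctx σ Γ) s) : BFormula L σ Γ
  | rel {Γ : List L.Sorts} (R : L.Rel)
      (ts : ∀ i : Fin (L.ar R).length, L.Term (ctx σ Γ) ((L.ar R).get i)) : BFormula L σ Γ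
  | imp {Γ : List L.Sorts} (φ ψ : BFormula L σ Γ) : BFormula L σ Γ
  | all {Γ : List L.Sorts} (s : L.Sorts) (φ : BFormula L σ (s :: Γ)) : BFormula L σ Γ

/-- First-order formulas whose free variables are among `α`. -/
abbrev Formula (L : SortedLanguage.{u}) {α : Type w} (σ : α → L.Sorts) : Type (max u w) :=
  L.BFormula σ []

/-- The concatenation of two tuples. -/
def join {S : Type u} {M : S → Type u} {α : Type w} {β : Type w'} {σ : α → S} {τ : β → S}
    (v : ∀ a, M (σ a)) (w : ∀ b, M (τ b)) : ∀ c : α ⊕ β, M (Sum.elim σ τ c)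
  | .inl a => v a
  | .inr b => w b

/-- The value of a term under an assignment. -/
def Term.realize {L : SortedLanguage.{u}} {M : L.Sorts → Type u} [L.Structure M] {α : Type w}
    {σ : α → L.Sorts} (v : ∀ a, M (σ a)) : ∀ {s : L.Sorts}, L.Term σ s → M s
  | _, .var a => v a
  | _, .func f ts => Structure.funMap f (fun i => (ts i).realize v)

/-- Truth of a formula under an assignment `v` of the free variables and an assignment `xs` of the
de Bruijn variables. -/
def BFormula.Realize {L : SortedLanguage.{u}} {M : L.Sorts → Type u} [L.Structure M] {α : Type w}
    {σ : α → L.Sorts} (v : ∀ a, M (σ a)) :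
    ∀ {Γ : List L.Sorts}, L.BFormula σ Γ → (∀ i : Fin Γ.length, M (Γ.get i)) → Prop
  | _, .falsum, _ => False
  | _, .equal t₁ t₂, xs => t₁.realize (join v xs) = t₂.realize (join v xs)
  | _, .rel R ts, xs => Structure.relMap R (fun i => (ts i).realize (join v xs))
  | _, .imp φ ψ, xs => φ.Realize v xs → ψ.Realize v xs
  | Γ, .all s φ, xs => ∀ x : M s,
      φ.Realize v (Fin.cons (α := fun i : Fin (Γ.length + 1) => M ((s :: Γ).get i)) x xs)

/-- `φ.Holds v` : the tuple `v` satisfies the formula `φ`. -/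
def Formula.Holds {L : SortedLanguage.{u}} {M : L.Sorts → Type u} [L.Structure M] {α : Type w}
    {σ : α → L.Sorts} (φ : L.Formula σ) (v : ∀ a, M (σ a)) : Prop :=
  BFormula.Realize v φ (fun i => i.elim0)

/-- Substitution of variables for the variables of a term (sort-preserving, possibly identifying
variables). -/
def Term.relabel {L : SortedLanguage.{u}} {α : Type w} {β : Type w'} {σ : α → L.Sorts}
    {τ : β → L.Sorts} (f : α → β) (h : ∀ a, τ (f a) = σ a) :
    ∀ {s : L.Sorts}, L.Term σ s → L.Term τ s
  | _, .var a => h a ▸ Term.var (f a)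
  | _, .func g ts => .func g (fun i => (ts i).relabel f h)

theorem ctx_map {L : SortedLanguage.{u}} {α : Type w} {β : Type w'} {σ : α → L.Sorts}
    {τ : β → L.Sorts} (f : α → β) (h : ∀ a, τ (f a) = σ a) (Γ : List L.Sorts) :
    ∀ c, ctx τ Γ (Sum.map f id c) = ctx σ Γ c
  | .inl a => h a
  | .inr _ => rfl

theorem elim_map {S : Type u} {X U : Type w} {Y V : Type w'} {sx : X → S} {sy : Y → S}
    {su : U → S} {sv : V → S} (f : X → U) (g : Y → V) (hf : ∀ x, su (f x) = sx x)
    (hg : ∀ y, sv (g y) = sy y) : ∀ c, Sum.elim su sv (Sum.map f g c) = Sum.elim sx sy c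
  | .inl x => hf x
  | .inr y => hg y

theorem elim_assoc {S : Type u} {X Y Z : Type w} (sx : X → S) (sz : Z → S) (sy : Y → S) :
    ∀ c, Sum.elim sx (Sum.elim sz sy) (Equiv.sumAssoc X Z Y c) =
      Sum.elim (Sum.elim sx sz) sy c
  | .inl (.inl _) => rfl
  | .inl (.inr _) => rfl
  | .inr _ => rfl

theorem elim_inr {S : Type u} {Z Y : Type} (sz : Z → S) (sy : Y → S) (k : ℕ) (q : Fin k × Y) :
    (fun q : Fin k × (Z ⊕ Y) => Sum.elim sz sy q.2) (q.1, Sum.inr q.2) = sy q.2 := rfl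

/-- Substitution of variables for the free variables of a formula. -/
def BFormula.relabel {L : SortedLanguage.{u}} {α : Type w} {β : Type w'} {σ : α → L.Sorts}
    {τ : β → L.Sorts} (f : α → β) (h : ∀ a, τ (f a) = σ a) :
    ∀ {Γ : List L.Sorts}, L.BFormula σ Γ → L.BFormula τ Γ
  | _, .falsum => .falsum
  | Γ, .equal t₁ t₂ =>
      .equal (t₁.relabel (Sum.map f id) (ctx_map f h Γ)) (t₂.relabel (Sum.map f id) (ctx_map f h Γ))
  | Γ, .rel R ts => .rel R (fun i => (ts i).relabel (Sum.map f id) (ctx_map f h Γ))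
  | _, .imp φ ψ => .imp (φ.relabel f h) (ψ.relabel f h)
  | _, .all s φ => .all s (φ.relabel f h)

/-- Truth. -/
def BFormula.verum {L : SortedLanguage.{u}} {α : Type w} {σ : α → L.Sorts} {Γ : List L.Sorts} :
    L.BFormula σ Γ := .imp .falsum .falsum

/-- Conjunction. -/
def BFormula.and {L : SortedLanguage.{u}} {α : Type w} {σ : α → L.Sorts} {Γ : List L.Sorts}
    (φ ψ : L.BFormula σ Γ) : L.BFormula σ Γ := .imp (.imp φ (.imp ψ .falsum)) .falsum

/-- Finite conjunction. -/
noncomputable def BFormula.conj {L : SortedLanguage.{u}} {α : Type w} {σ : α → L.Sorts}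
    {Γ : List L.Sorts} {ι : Type} [Finite ι] (φ : ι → L.BFormula σ Γ) : L.BFormula σ Γ :=
  letI := Fintype.ofFinite ι
  ((Finset.univ : Finset ι).toList.map φ).foldr BFormula.and BFormula.verum

/-- A free variable as a term. -/
def Term.free {L : SortedLanguage.{u}} {α : Type w} {σ : α → L.Sorts} (a : α) :
    L.Term (ctx σ []) (σ a) := Term.var (σ := ctx σ []) (Sum.inl a)

/-! ### The big model: elements, types, algebraic closure, automorphisms -/

section Model

variable {L : SortedLanguage.{u}} (M : L.Sorts → Type u) [L.Structure M]

/-- The elements of the structure, of all sorts. -/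
abbrev Elem : Type u := Σ s : L.Sorts, M s

variable {M}

/-- All entries of the tuple `v` lie in the set `A`. -/
def TupleIn {α : Type w} {σ : α → L.Sorts} (v : ∀ a, M (σ a)) (A : Set (Elem M)) : Prop :=
  ∀ a, (⟨σ a, v a⟩ : Elem M) ∈ A

/-- The set of entries of a tuple. -/
def entries {α : Type w} {σ : α → L.Sorts} (v : ∀ a, M (σ a)) : Set (Elem M) :=
  {e | ∃ a, e = ⟨σ a, v a⟩}

/-- Formulas in the free variables `α` with parameters from `C`: the elements of `C` are used as
names for themselves. -/
abbrev FormulaOver {α : Type w} (σ : α → L.Sorts) (C : Set (Elem M)) : Type (max u w) :=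
  L.Formula (Sum.elim σ (fun c : C => c.1.1))

/-- Truth of a formula with parameters. -/
def HoldsOver {α : Type w} {σ : α → L.Sorts} {C : Set (Elem M)} (φ : FormulaOver σ C)
    (v : ∀ a, M (σ a)) : Prop :=
  Formula.Holds φ (join (τ := fun c : C => c.1.1) v (fun c : C => c.1.2))

/-- `v'` realises the complete type `tp(v / C)`. -/
def RealisesType {α : Type w} {σ : α → L.Sorts} (C : Set (Elem M)) (v v' : ∀ a, M (σ a)) :
    Prop :=
  ∀ φ : FormulaOver σ C, HoldsOver φ v → HoldsOver φ v'

/-- Algebraic closure: elements satisfying a formula over `C` with only finitely many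
solutions. -/
def acl (C : Set (Elem M)) : Set (Elem M) :=
  {e | ∃ φ : FormulaOver (fun _ : Unit => e.1) C,
    HoldsOver φ (fun _ => e.2) ∧ {x : M e.1 | HoldsOver φ (fun _ => x)}.Finite}

variable (M) in
/-- Automorphisms of the structure. -/
structure Aut where
  toEquiv : ∀ s : L.Sorts, M s ≃ M s
  map_fun : ∀ (f : L.Fn) (x : ∀ i, M ((L.dom f).get i)),
    toEquiv _ (Structure.funMap f x) = Structure.funMap f (fun i => toEquiv _ (x i))
  map_rel : ∀ (R : L.Rel) (x : ∀ i, M ((L.ar R).get i)),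
    Structure.relMap R (fun i => toEquiv _ (x i)) ↔ Structure.relMap R x

/-- The action of an automorphism on elements. -/
def Aut.act (g : Aut M) (e : Elem M) : Elem M := ⟨e.1, g.toEquiv e.1 e.2⟩

/-- `A ≡_C A'`: some automorphism fixes `C` pointwise and maps the set `A` onto the set `A'`. -/
def Conj (C A A' : Set (Elem M)) : Prop :=
  ∃ g : Aut M, (∀ c ∈ C, g.act c = c) ∧ g.act '' A = A'

/-- `κ`-saturation: every finitely satisfiable set of formulas in one variable (of any sort) over
fewer than `κ` parameters is realised. -/
def IsSaturated (M : L.Sorts → Type u) [L.Structure M] (κ : Cardinal.{u}) : Prop :=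
  ∀ C : Set (Elem M), #C < κ → ∀ (s : L.Sorts) (p : Set (FormulaOver (fun _ : Unit => s) C)),
    (∀ q ⊆ p, q.Finite → ∃ x : M s, ∀ φ ∈ q, HoldsOver φ (fun _ => x)) →
      ∃ x : M s, ∀ φ ∈ p, HoldsOver φ (fun _ => x)

/-- Strong `κ`-homogeneity: two tuples of length less than `κ` with the same type over `∅` are
conjugate under an automorphism. -/
def IsStronglyHomogeneous (M : L.Sorts → Type u) [L.Structure M] (κ : Cardinal.{u}) : Prop :=
  ∀ (ι : Type u), #ι < κ → ∀ (σ : ι → L.Sorts) (a b : ∀ i, M (σ i)),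
    (∀ φ : L.Formula σ, φ.Holds a ↔ φ.Holds b) → ∃ g : Aut M, ∀ i, g.toEquiv _ (a i) = b i

/-- `M` is a big model of its complete theory, where `small` means of cardinality less than `κ`. -/
structure IsBigModel (M : L.Sorts → Type u) [L.Structure M] (κ : Cardinal.{u}) : Prop where
  nonempty : ∀ s, Nonempty (M s)
  aleph0_lt : ℵ₀ < κ
  card_lt : L.card < κ
  saturated : IsSaturated M κ
  homogeneous : IsStronglyHomogeneous M κ

/-- Small subsets of the big model. -/
def IsSmall (κ : Cardinal.{u}) (A : Set (Elem M)) : Prop := #A < κ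

/-- M-dividing independence; `MIndep A C B` is "`A` is independent from `B` over `C`". -/
def MIndep (A C B : Set (Elem M)) : Prop :=
  ∀ C', C ⊆ C' → C' ⊆ acl (B ∪ C) → acl (A ∪ C') ∩ acl (B ∪ C') = acl C'

/-- Thorn-forking independence. -/
def ThornIndep (κ : Cardinal.{u}) (A C B : Set (Elem M)) : Prop :=
  ∀ B', IsSmall κ B' → B ⊆ B' → ∃ A', Conj (B ∪ C) A A' ∧ MIndep A' C B'

/-- The relation derived from a relation `R` by forcing the extension axiom. -/
def StarIndep (κ : Cardinal.{u}) (R : Set (Elem M) → Set (Elem M) → Set (Elem M) → Prop)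
    (A C B : Set (Elem M)) : Prop :=
  ∀ B', IsSmall κ B' → B ⊆ B' → ∃ A', Conj (B ∪ C) A A' ∧ R A' C B'

end Model

/-! ### Inconsistency pairs and local dividing -/

/-- A pair `(φ(x̄; ȳ), ψ(ȳ_{<k}))` of formulas. The finite types `X` and `Y` index the variables in
the blocks `x̄` and `ȳ`; the variable `(i, y) : Fin k × Y` of `ψ` is the `i`-th copy of `y`. -/
structure FormulaPair (L : SortedLanguage.{u}) where
  X : Type
  Y : Type
  finX : Finite X
  finY : Finite Y
  sx : X → L.Sorts
  sy : Y → L.Sorts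
  k : ℕ
  φ : L.Formula (Sum.elim sx sy)
  ψ : L.Formula (fun q : Fin k × Y => sy q.2)

/-- The formula `ψ(ȳ_{<k}) ∧ z̄₀ = z̄₁ = ⋯ = z̄_{k-1}` in `k` copies of the variables `z̄, ȳ`. -/
noncomputable def normalWitness {L : SortedLanguage.{u}} {Z Y : Type} [Finite Z]
    (sz : Z → L.Sorts) (sy : Y → L.Sorts) (k : ℕ) (ψ : L.Formula (fun q : Fin k × Y => sy q.2)) :
    L.Formula (fun q : Fin k × (Z ⊕ Y) => Sum.elim sz sy q.2) :=
  BFormula.and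
    (BFormula.relabel (τ := fun q : Fin k × (Z ⊕ Y) => Sum.elim sz sy q.2)
      (fun q : Fin k × Y => (q.1, Sum.inr q.2)) (elim_inr sz sy k) ψ)
    (BFormula.conj (fun t : Z × Fin k × Fin k =>
      .equal (s := sz t.1)
        (Term.free (σ := fun q : Fin k × (Z ⊕ Y) => Sum.elim sz sy q.2) (t.2.1, Sum.inl t.1))
        (Term.free (σ := fun q : Fin k × (Z ⊕ Y) => Sum.elim sz sy q.2) (t.2.2, Sum.inl t.1))))

section Dividing

variable {L : SortedLanguage.{u}} (M : L.Sorts → Type u) [L.Structure M]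

/-- The set `Ξ` of all inconsistency pairs: `φ(x̄; ȳ₀) ∧ ⋯ ∧ φ(x̄; ȳ_{k-1}) ∧ ψ(ȳ_{<k})` is
inconsistent (with the complete theory of `M`, that is, not satisfied in `M`). -/
def Xi : Set (FormulaPair L) :=
  {p | ¬ ∃ (a : ∀ x, M (p.sx x)) (b : Fin p.k → ∀ y, M (p.sy y)),
    (∀ i, p.φ.Holds (join a (b i))) ∧ p.ψ.Holds (fun q => b q.1 q.2)}

/-- The set `Ξ_M`: the variables `ȳ` are listed by `u v̄` and `ψ` is equivalent to
`⋀_{i<j<k} (uᵢ ≠ uⱼ ∧ v̄ᵢ = v̄ⱼ)`. Here `u : Y` and `V` is the set of variables in the tuple `v̄`.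
As everywhere, a tuple of variables may have repetitions, so `u ∈ V` is not excluded; this makes
the set closed under variable substitution (and if `u ∈ V` and `2 ≤ k`, then `ψ` is
inconsistent). -/
def XiM : Set (FormulaPair L) :=
  {p | p ∈ Xi M ∧ ∃ (u : p.Y) (V : Set p.Y), (∀ y, y = u ∨ y ∈ V) ∧
    ∀ b : Fin p.k → ∀ y, M (p.sy y),
      p.ψ.Holds (fun q => b q.1 q.2) ↔
        ∀ i j, i < j → b i u ≠ b j u ∧ ∀ v ∈ V, b i v = b j v}

variable {M}

/-- `φ(x̄; b̄)` `(φ, ψ)`-divides over `C`. -/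
def FormulaDivides (p : FormulaPair L) (C : Set (Elem M)) (b : ∀ y, M (p.sy y)) : Prop :=
  p ∈ Xi M ∧ ∃ bs : ℕ → ∀ y, M (p.sy y),
    (∀ i, RealisesType C b (bs i)) ∧
      ∀ f : Fin p.k → ℕ, StrictMono f → p.ψ.Holds (fun q => bs (f q.1) q.2)

/-- `tp(ā / B)` `(φ, ψ)`-divides over `C`: it contains a formula `φ(x̄; b̄)` with `b̄ ∈ B` that
`(φ, ψ)`-divides over `C`. -/
def TypeDivides (p : FormulaPair L) (C B : Set (Elem M)) (a : ∀ x, M (p.sx x)) : Prop :=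
  ∃ b : ∀ y, M (p.sy y), TupleIn b B ∧ p.φ.Holds (join a b) ∧ FormulaDivides p C b

/-- `Ω`-dividing independence: there is no tuple `ā` in `A` such that `tp(ā / BC)` `Ω`-divides over
`C`. (Only the entries of `ā` that are substituted for the finitely many variables of `φ`
matter.) -/
def OmegaIndep (Ω : Set (FormulaPair L)) (A C B : Set (Elem M)) : Prop :=
  ¬ ∃ p ∈ Ω, ∃ a : ∀ x, M (p.sx x), TupleIn a A ∧ TypeDivides p C (B ∪ C) a

/-- Closure under variable substitution: the variables of `x̄` and of `ȳ` are replaced by new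
variables, possibly identifying some variables within a block, in the same way in each copy of
`ȳ`. -/
def ClosedUnderSubst (Ω : Set (FormulaPair L)) : Prop :=
  ∀ p ∈ Ω, ∀ (U V : Type) (finU : Finite U) (finV : Finite V) (su : U → L.Sorts)
    (sv : V → L.Sorts) (f : p.X → U) (g : p.Y → V) (hf : ∀ x, su (f x) = p.sx x)
    (hg : ∀ y, sv (g y) = p.sy y), Function.Surjective f → Function.Surjective g →
    (⟨U, V, finU, finV, su, sv, p.k,
      p.φ.relabel (Sum.map f g) (elim_map f g hf hg),
      p.ψ.relabel (fun q : Fin p.k × p.Y => (q.1, g q.2)) (fun q => hg q.2)⟩ : FormulaPair L) ∈ Ω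

variable (M) in
/-- Transitivity of a set `Ω` of inconsistency pairs. -/
def IsTransitive (κ : Cardinal.{u}) (Ω : Set (FormulaPair L)) : Prop :=
  ∀ p ∈ Ω, ∀ (C D : Set (Elem M)) (a : ∀ y, M (p.sy y)), IsSmall κ C → D ⊆ C →
    OmegaIndep Ω C D (entries a) → FormulaDivides p D a → FormulaDivides p C a

/-- Normality of a set `Ω` of inconsistency pairs: if `(φ(x̄, z̄; ȳ), ψ(ȳ_{<k}))` is in `Ω`, then so
is `(φ(x̄; z̄, ȳ), ψ(ȳ_{<k}) ∧ z̄₀ = z̄₁ = ⋯ = z̄_{k-1})`. -/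
def IsNormal (Ω : Set (FormulaPair L)) : Prop :=
  ∀ (X Z Y : Type) (finX : Finite X) (_finZ : Finite Z) (finY : Finite Y) (sx : X → L.Sorts)
    (sz : Z → L.Sorts) (sy : Y → L.Sorts) (k : ℕ)
    (φ : L.Formula (Sum.elim (Sum.elim sx sz) sy)) (ψ : L.Formula (fun q : Fin k × Y => sy q.2)),
    (⟨X ⊕ Z, Y, inferInstance, finY, Sum.elim sx sz, sy, k, φ, ψ⟩ : FormulaPair L) ∈ Ω →
    (⟨X, Z ⊕ Y, finX, inferInstance, sx, Sum.elim sz sy, k,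
      φ.relabel (Equiv.sumAssoc X Z Y) (elim_assoc sx sz sy),
      normalWitness sz sy k ψ⟩ : FormulaPair L) ∈ Ω

end Dividing

end SortedLanguage

open SortedLanguage

namespace SortedLanguage

section

variable {L : SortedLanguage.{u}} {M : L.Sorts → Type u} [L.Structure M]

/-! ### Substitution of variables -/

/-! For a pair in `Ξ_M`, the formula `ψ` forces the copies of `u` to be distinct and all other
variables to be constant. Everything reduces to one characterisation: if `2 ≤ k`, then `φ(x̄; b̄)`
divides over `C` exactly when `u ∉ V` and the entry `b_u` is not algebraic over `C` together with
the other entries of `b̄`. If `b_u` is not algebraic, saturation gives infinitely many realisations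
of its type, and substituting them for `b_u` gives the dividing sequence
(`formulaDivides_of_notMem_acl`). Conversely, a dividing sequence would put infinitely many
solutions into a single instance of an algebraic formula whose number of solutions is bounded
uniformly in the parameters (`FormulaDivides.notMem_acl`). If `k < 2`, then `ψ` is vacuous, so `φ`
itself is inconsistent.

Inconsistency of the pair says that `φ(ā; u, v̄)` has fewer than `k` solutions in `u` for fixed `ā`,
`v̄`; it is thus a uniform witness of algebraicity over `ā v̄`. Hence dividing exhibits an element
of `B` that is algebraic over `AD` but not over `D`, where `D` is `C` with the remaining parameters.
Conversely, an algebraic formula for such an element, cut down so that its bound holds for all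
parameters, yields a pair in `Ξ_M`. This is `omegaIndep_xiM_iff`.

Transitivity follows by applying this criterion to `D` with the entries of `ā` other than `a_u`;
normality only adds `z̄` to the constant variables. M-independence gives the criterion at once. In
the other direction the criterion must be applied with `acl(BC)` in place of `B`, which the star
operation permits because `acl` of a small set is small (`isSmall_acl`, by counting formulas).

Syntax is handled through definable predicates (`Def`, `DefOver`), so that formulas rarely have to
be written down. -/

/-- Agreement of the assignments is stated in `Elem M`, where sort and value are compared together,
so that no casts between carriers occur. -/
theorem Term.realize_relabel {α : Type w} {β : Type w'} {σ : α → L.Sorts} {τ : β → L.Sorts}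
    (f : α → β) (h : ∀ a, τ (f a) = σ a) (v : ∀ b, M (τ b)) (w : ∀ a, M (σ a))
    (hvw : ∀ a, (⟨τ (f a), v (f a)⟩ : Elem M) = ⟨σ a, w a⟩) {s : L.Sorts} (t : L.Term σ s) :
    (t.relabel f h).realize v = t.realize w := by
  induction t with
  | var a =>
    -- Generalising the target sort lets the transport be eliminated by reflexivity.
    have key : ∀ (s : L.Sorts) (e : τ (f a) = s),
        (⟨s, (e ▸ Term.var (f a) : L.Term τ s).realize v⟩ : Elem M) = ⟨τ (f a), v (f a)⟩ := by
      rintro s rfl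
      rfl
    have := (key _ (h a)).trans (hvw a)
    simpa [Term.relabel, Term.realize] using this
  | func g ts ih =>
    simp only [Term.relabel, Term.realize]
    congr 1
    funext i
    exact ih i

theorem BFormula.realize_relabel {α : Type w} {β : Type w'} {σ : α → L.Sorts} {τ : β → L.Sorts}
    (f : α → β) (h : ∀ a, τ (f a) = σ a) (v : ∀ b, M (τ b)) (w : ∀ a, M (σ a))
    (hvw : ∀ a, (⟨τ (f a), v (f a)⟩ : Elem M) = ⟨σ a, w a⟩) {Γ : List L.Sorts}
    (φ : L.BFormula σ Γ) (xs : ∀ i : Fin Γ.length, M (Γ.get i)) :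
    (φ.relabel f h).Realize v xs ↔ φ.Realize w xs := by
  have hj : ∀ (Γ : List L.Sorts) (xs : ∀ i : Fin Γ.length, M (Γ.get i)) (c : α ⊕ Fin Γ.length),
      (⟨ctx τ Γ (Sum.map f id c), join v xs (Sum.map f id c)⟩ : Elem M) =
        ⟨ctx σ Γ c, join w xs c⟩ := by
    rintro Γ xs (a | i)
    · exact hvw a
    · rfl
  induction φ with
  | falsum => rfl
  | equal t₁ t₂ =>
    simp only [BFormula.relabel, BFormula.Realize]
    rw [Term.realize_relabel _ _ _ _ (hj _ xs), Term.realize_relabel _ _ _ _ (hj _ xs)]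
  | rel R ts =>
    simp only [BFormula.relabel, BFormula.Realize]
    simp only [Term.realize_relabel _ _ _ _ (hj _ xs)]
  | imp φ ψ ih₁ ih₂ =>
    simp only [BFormula.relabel, BFormula.Realize, ih₁, ih₂]
  | all s φ ih =>
    simp only [BFormula.relabel, BFormula.Realize, ih]

theorem Formula.holds_relabel {α : Type w} {β : Type w'} {σ : α → L.Sorts} {τ : β → L.Sorts}
    (f : α → β) (h : ∀ a, τ (f a) = σ a) (v : ∀ b, M (τ b)) (w : ∀ a, M (σ a))
    (hvw : ∀ a, (⟨τ (f a), v (f a)⟩ : Elem M) = ⟨σ a, w a⟩) (φ : L.Formula σ) :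
    Formula.Holds (BFormula.relabel f h φ) v ↔ φ.Holds w :=
  BFormula.realize_relabel f h v w hvw φ _

/-- Extension of a map between free and bound variables to one more bound variable. -/
def liftVar {α : Type w} {β : Type w'} {Γ Δ : List L.Sorts} (s : L.Sorts)
    (f : α ⊕ Fin Γ.length → β ⊕ Fin Δ.length) :
    α ⊕ Fin (s :: Γ).length → β ⊕ Fin (s :: Δ).length
  | .inl a => Sum.map id Fin.succ (f (.inl a))
  | .inr i => Fin.cases (motive := fun _ => β ⊕ Fin (Δ.length + 1)) (.inr 0)
      (fun j => Sum.map id Fin.succ (f (.inr j))) i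

theorem ctx_succ {β : Type w'} {τ : β → L.Sorts} {Δ : List L.Sorts} (s : L.Sorts)
    (c : β ⊕ Fin Δ.length) : ctx τ (s :: Δ) (Sum.map id Fin.succ c) = ctx τ Δ c := by
  cases c <;> rfl

theorem ctx_liftVar {α : Type w} {β : Type w'} {σ : α → L.Sorts} {τ : β → L.Sorts}
    {Γ Δ : List L.Sorts} (s : L.Sorts) (f : α ⊕ Fin Γ.length → β ⊕ Fin Δ.length)
    (h : ∀ c, ctx τ Δ (f c) = ctx σ Γ c) :
    ∀ c, ctx τ (s :: Δ) (liftVar s f c) = ctx σ (s :: Γ) c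
  | .inl a => (ctx_succ s _).trans (h (.inl a))
  | .inr i => by
    refine Fin.cases ?_ (fun j => ?_) i
    · rfl
    · exact (ctx_succ s _).trans (h (.inr j))

/-- Substitution of variables for all variables, free or bound by the context. -/
def BFormula.mapVars {α : Type w} {β : Type w'} {σ : α → L.Sorts} {τ : β → L.Sorts} :
    ∀ {Γ Δ : List L.Sorts} (f : α ⊕ Fin Γ.length → β ⊕ Fin Δ.length)
      (_ : ∀ c, ctx τ Δ (f c) = ctx σ Γ c), L.BFormula σ Γ → L.BFormula τ Δ
  | _, _, _, _, .falsum => .falsum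
  | _, _, f, h, .equal t₁ t₂ => .equal (t₁.relabel f h) (t₂.relabel f h)
  | _, _, f, h, .rel R ts => .rel R (fun i => (ts i).relabel f h)
  | _, _, f, h, .imp φ ψ => .imp (φ.mapVars f h) (ψ.mapVars f h)
  | _, _, f, h, .all s φ => .all s (φ.mapVars (liftVar s f) (ctx_liftVar s f h))

/-- Unlike `BFormula.relabel`, this substitution may turn free variables into context variables,
which is what quantifying over a free variable in `Def.all` needs. -/
theorem BFormula.realize_mapVars {α : Type w} {β : Type w'} {σ : α → L.Sorts} {τ : β → L.Sorts}
    {Γ : List L.Sorts} (φ : L.BFormula σ Γ) (v : ∀ b, M (τ b)) (w : ∀ a, M (σ a)) :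
    ∀ {Δ : List L.Sorts} (f : α ⊕ Fin Γ.length → β ⊕ Fin Δ.length)
    (h : ∀ c, ctx τ Δ (f c) = ctx σ Γ c)
    (xs : ∀ i : Fin Γ.length, M (Γ.get i)) (ys : ∀ i : Fin Δ.length, M (Δ.get i))
    (_ : ∀ c, (⟨ctx τ Δ (f c), join v ys (f c)⟩ : Elem M) = ⟨ctx σ Γ c, join w xs c⟩),
    (φ.mapVars f h).Realize v ys ↔ φ.Realize w xs := by
  induction φ with
  | falsum => intros; rfl
  | equal t₁ t₂ =>
    intro Δ f h xs ys hvw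
    simp only [BFormula.mapVars, BFormula.Realize]
    rw [Term.realize_relabel _ _ _ _ hvw, Term.realize_relabel _ _ _ _ hvw]
  | rel R ts =>
    intro Δ f h xs ys hvw
    simp only [BFormula.mapVars, BFormula.Realize]
    simp only [Term.realize_relabel _ _ _ _ hvw]
  | imp φ ψ ih₁ ih₂ =>
    intro Δ f h xs ys hvw
    simp only [BFormula.mapVars, BFormula.Realize, ih₁ f h xs ys hvw, ih₂ f h xs ys hvw]
  | @all Γ s φ ih =>
    intro Δ f h xs ys hvw
    simp only [BFormula.mapVars, BFormula.Realize]
    refine forall_congr' fun x => ih _ _ _ _ ?_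
    have hs : ∀ c : β ⊕ Fin Δ.length,
        (⟨ctx τ (s :: Δ) (Sum.map id Fin.succ c), join (σ := τ) (τ := (s :: Δ).get) v
          (Fin.cons (α := fun i : Fin (Δ.length + 1) => M ((s :: Δ).get i)) x ys)
            (Sum.map id Fin.succ c)⟩ : Elem M) = ⟨ctx τ Δ c, join v ys c⟩ := by
      rintro (b | j) <;> rfl
    rintro (a | i)
    · exact (hs _).trans (hvw (.inl a))
    · refine Fin.cases ?_ (fun j => ?_) i
      · rfl
      · exact (hs _).trans (hvw (.inr j))

/-! ### Definable predicates -/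

/-- The predicate `P` is defined by a formula without parameters. -/
def Def {α : Type w} (σ : α → L.Sorts) (P : (∀ a, M (σ a)) → Prop) : Prop :=
  ∃ φ : L.Formula σ, ∀ v, φ.Holds v ↔ P v

section Def

variable {α : Type w} {β : Type w'} {σ : α → L.Sorts} {τ : β → L.Sorts}

theorem Formula.def (φ : L.Formula σ) : Def (M := M) σ φ.Holds := ⟨φ, fun _ => Iff.rfl⟩

theorem Def.congr {P Q : (∀ a, M (σ a)) → Prop} (hP : Def σ P) (h : ∀ v, Q v ↔ P v) :
    Def σ Q :=
  hP.imp fun _ hφ v => (hφ v).trans (h v).symm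

theorem Def.false : Def (M := M) σ fun _ => False := ⟨.falsum, fun _ => Iff.rfl⟩

theorem Def.imp {P Q : (∀ a, M (σ a)) → Prop} (hP : Def σ P) (hQ : Def σ Q) :
    Def σ fun v => P v → Q v := by
  obtain ⟨φ, hφ⟩ := hP
  obtain ⟨ψ, hψ⟩ := hQ
  exact ⟨.imp φ ψ, fun v => imp_congr (hφ v) (hψ v)⟩

theorem Def.not {P : (∀ a, M (σ a)) → Prop} (hP : Def σ P) : Def σ fun v => ¬ P v :=
  hP.imp Def.false

theorem Def.and {P Q : (∀ a, M (σ a)) → Prop} (hP : Def σ P) (hQ : Def σ Q) :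
    Def σ fun v => P v ∧ Q v :=
  (hP.imp hQ.not).not.congr fun v => by tauto

theorem BFormula.realize_and {Γ : List L.Sorts} (φ ψ : L.BFormula σ Γ) (v : ∀ a, M (σ a))
    (xs : ∀ i : Fin Γ.length, M (Γ.get i)) :
    (φ.and ψ).Realize v xs ↔ φ.Realize v xs ∧ ψ.Realize v xs := by
  simp only [BFormula.and, BFormula.Realize]
  tauto

theorem BFormula.realize_conj {Γ : List L.Sorts} {ι : Type} [Finite ι] (φ : ι → L.BFormula σ Γ)
    (v : ∀ a, M (σ a)) (xs : ∀ i : Fin Γ.length, M (Γ.get i)) :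
    (BFormula.conj φ).Realize v xs ↔ ∀ i, (φ i).Realize v xs := by
  have key : ∀ l : List ι, ((l.map φ).foldr BFormula.and BFormula.verum).Realize v xs ↔
      ∀ i ∈ l, (φ i).Realize v xs := by
    intro l
    induction l with
    | nil => simp [BFormula.verum, BFormula.Realize]
    | cons i l ih => simp [BFormula.realize_and, ih]
  simp [BFormula.conj, key]

theorem Def.forall_finite {ι : Type} [Finite ι] {P : ι → (∀ a, M (σ a)) → Prop}
    (hP : ∀ i, Def σ (P i)) : Def σ fun v => ∀ i, P i v := by
  choose φ hφ using hP
  exact ⟨BFormula.conj φ, fun v => (BFormula.realize_conj φ v _).trans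
    (forall_congr' fun i => hφ i v)⟩

theorem Def.eq_var (a b : α) :
    Def (M := M) σ fun v => (⟨σ a, v a⟩ : Elem M) = ⟨σ b, v b⟩ := by
  by_cases h : σ b = σ a
  · refine ⟨.equal (s := σ a) (Term.free a) (h ▸ Term.free b), fun v => ?_⟩
    have key : ∀ (s : L.Sorts) (e : σ b = s), (⟨s, (e ▸ Term.free b : L.Term (ctx σ []) s).realize
        (join v (fun i => i.elim0 : ∀ i : Fin 0, M (([] : List L.Sorts).get i)))⟩ : Elem M) =
          ⟨σ b, v b⟩ := by
      rintro s rfl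
      rfl
    beta_reduce
    rw [← key _ h]
    simp only [Formula.Holds, BFormula.Realize, Sigma.mk.injEq, heq_eq_eq, true_and]
    rfl
  · exact Def.false.congr fun v => ⟨fun e => h (congrArg Sigma.fst e).symm, _root_.False.elim⟩

theorem Def.comap {Q : (∀ a, M (σ a)) → Prop} (hQ : Def σ Q) (f : α → β)
    (h : ∀ a, τ (f a) = σ a) {P : (∀ b, M (τ b)) → Prop}
    (hPQ : ∀ v, ∃ w : ∀ a, M (σ a), (∀ a, (⟨τ (f a), v (f a)⟩ : Elem M) = ⟨σ a, w a⟩) ∧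
      (P v ↔ Q w)) : Def τ P := by
  obtain ⟨φ, hφ⟩ := hQ
  refine ⟨BFormula.relabel f h φ, fun v => ?_⟩
  obtain ⟨w, hw, hP⟩ := hPQ v
  rw [hP, Formula.holds_relabel f h v w hw, hφ]

theorem Def.all {s : L.Sorts} {P : (∀ c, M (Sum.elim σ (fun _ : Unit => s) c)) → Prop}
    (hP : Def (Sum.elim σ fun _ : Unit => s) P) :
    Def σ fun v => ∀ x : M s, P (join v (fun _ : Unit => x)) := by
  obtain ⟨φ, hφ⟩ := hP
  let f : (α ⊕ Unit) ⊕ Fin ([] : List L.Sorts).length → α ⊕ Fin [s].length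
    | .inl (.inl a) => .inl a
    | .inl (.inr _) => .inr 0
    | .inr i => i.elim0
  have hf : ∀ c, ctx σ [s] (f c) = ctx (Sum.elim σ fun _ : Unit => s) [] c := by
    rintro ((a | i) | i)
    · rfl
    · rfl
    · exact i.elim0
  refine ⟨.all s (BFormula.mapVars f hf φ), fun v => ?_⟩
  refine forall_congr' fun x => ?_
  rw [← hφ]
  refine BFormula.realize_mapVars _ _ _ _ _ _ _ ?_
  rintro ((a | i) | i)
  · rfl
  · rfl
  · exact i.elim0

theorem Def.ex {s : L.Sorts} {P : (∀ c, M (Sum.elim σ (fun _ : Unit => s) c)) → Prop}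
    (hP : Def (Sum.elim σ fun _ : Unit => s) P) :
    Def σ fun v => ∃ x : M s, P (join v (fun _ : Unit => x)) :=
  hP.not.all.not.congr fun v => by simp

/-- Induction on the length, with the free variables kept general: the first coordinate becomes a
free variable, the rest is quantified by induction, and then the first is quantified. -/
theorem Def.ex_tuple {n : ℕ} : ∀ {α : Type w} {σ : α → L.Sorts} {τ : Fin n → L.Sorts}
    {P : (∀ c, M (Sum.elim σ τ c)) → Prop} (_ : Def (Sum.elim σ τ) P),
    Def σ fun v => ∃ y : ∀ i, M (τ i), P (join v y) := by
  induction n with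
  | zero =>
    intro α σ τ P hP
    refine hP.comap (Sum.elim id fun i => i.elim0) ?_ fun v =>
      ⟨join v fun i => i.elim0, ?_, ?_⟩
    · rintro (a | i)
      · rfl
      · exact i.elim0
    · rintro (a | i)
      · rfl
      · exact i.elim0
    · constructor
      · rintro ⟨y, hy⟩
        convert hy
      · exact fun h => ⟨_, h⟩
  | succ n ih =>
    intro α σ τ P hP
    let f : α ⊕ Fin (n + 1) → (α ⊕ Unit) ⊕ Fin n :=
      Sum.elim (fun a => .inl (.inl a)) (Fin.cases (.inl (.inr ())) fun j => .inr j)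
    have h₁ : Def (M := M) (Sum.elim (Sum.elim σ fun _ : Unit => τ 0) fun i : Fin n => τ i.succ)
        fun z => P (join (fun a => z (.inl (.inl a)))
          (Fin.cons (α := fun i => M (τ i)) (z (.inl (.inr ()))) fun j => z (.inr j))) := by
      refine hP.comap f ?_ fun z => ⟨_, ?_, Iff.rfl⟩
      · rintro (a | i)
        · rfl
        · refine Fin.cases ?_ (fun j => ?_) i <;> rfl
      · rintro (a | i)
        · rfl
        · refine Fin.cases ?_ (fun j => ?_) i <;> rfl
    refine (ih h₁).ex.congr fun v => ?_
    constructor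
    · rintro ⟨y, hy⟩
      refine ⟨y 0, fun j => y j.succ, ?_⟩
      have e : Fin.cons (α := fun i => M (τ i)) (y 0) (fun j => y j.succ) = y :=
        Fin.cons_self_tail (α := fun i => M (τ i)) y
      rw [← e] at hy
      exact hy
    · rintro ⟨x, y, hy⟩
      exact ⟨_, hy⟩

end Def

/-! ### Finite support -/

theorem Term.exists_support {α : Type w} {σ : α → L.Sorts} {Γ : List L.Sorts} {s : L.Sorts}
    (t : L.Term (ctx σ Γ) s) : ∃ S : Set α, S.Finite ∧ ∀ T : Set α, S ⊆ T →
      ∃ t' : L.Term (ctx (fun a : T => σ a) Γ) s, ∀ (v : ∀ a, M (σ a)) (xs),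
        t'.realize (M := M) (join (fun a : T => v a) xs) = t.realize (join v xs) := by
  induction t with
  | var c =>
    rcases c with a | i
    · refine ⟨{a}, Set.finite_singleton a, fun T hT =>
        ⟨Term.var (σ := ctx (fun a : T => σ a) Γ) (.inl ⟨a, hT rfl⟩), fun v xs => rfl⟩⟩
    · exact ⟨∅, Set.finite_empty, fun T _ =>
        ⟨Term.var (σ := ctx (fun a : T => σ a) Γ) (.inr i), fun v xs => rfl⟩⟩
  | func f ts ih =>
    choose S hS hT using ih
    refine ⟨⋃ i, S i, Set.finite_iUnion hS, fun T h => ?_⟩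
    choose t' ht' using fun i => hT i T ((Set.subset_iUnion S i).trans h)
    refine ⟨.func f t', fun v xs => ?_⟩
    simp only [Term.realize, ht']

/-- Allowing every `T ⊇ S` lets the supports of subformulas be enlarged to a common one in the
induction. -/
theorem BFormula.exists_support {α : Type w} {σ : α → L.Sorts} {Γ : List L.Sorts}
    (φ : L.BFormula σ Γ) : ∃ S : Set α, S.Finite ∧ ∀ T : Set α, S ⊆ T →
      ∃ φ' : L.BFormula (fun a : T => σ a) Γ, ∀ (v : ∀ a, M (σ a)) (xs),
        φ'.Realize (fun a : T => v a) xs ↔ φ.Realize v xs := by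
  induction φ with
  | falsum => exact ⟨∅, Set.finite_empty, fun T _ => ⟨.falsum, fun _ _ => Iff.rfl⟩⟩
  | equal t₁ t₂ =>
    obtain ⟨S₁, hS₁, h₁⟩ := t₁.exists_support (M := M)
    obtain ⟨S₂, hS₂, h₂⟩ := t₂.exists_support (M := M)
    refine ⟨S₁ ∪ S₂, hS₁.union hS₂, fun T hT => ?_⟩
    obtain ⟨t₁', e₁⟩ := h₁ T (Set.subset_union_left.trans hT)
    obtain ⟨t₂', e₂⟩ := h₂ T (Set.subset_union_right.trans hT)
    refine ⟨.equal t₁' t₂', fun v xs => ?_⟩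
    simp only [BFormula.Realize, e₁, e₂]
  | rel R ts =>
    choose S hS hT using fun i => (ts i).exists_support (M := M)
    refine ⟨⋃ i, S i, Set.finite_iUnion hS, fun T h => ?_⟩
    choose t' ht' using fun i => hT i T ((Set.subset_iUnion S i).trans h)
    refine ⟨.rel R t', fun v xs => ?_⟩
    simp only [BFormula.Realize, ht']
  | imp φ ψ ih₁ ih₂ =>
    obtain ⟨S₁, hS₁, h₁⟩ := ih₁
    obtain ⟨S₂, hS₂, h₂⟩ := ih₂
    refine ⟨S₁ ∪ S₂, hS₁.union hS₂, fun T hT => ?_⟩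
    obtain ⟨t₁', e₁⟩ := h₁ T (Set.subset_union_left.trans hT)
    obtain ⟨t₂', e₂⟩ := h₂ T (Set.subset_union_right.trans hT)
    refine ⟨.imp t₁' t₂', fun v xs => ?_⟩
    simp only [BFormula.Realize, e₁, e₂]
  | all s φ ih =>
    obtain ⟨S, hS, h⟩ := ih
    refine ⟨S, hS, fun T hT => ?_⟩
    obtain ⟨φ', e⟩ := h T hT
    refine ⟨.all s φ', fun v xs => ?_⟩
    simp only [BFormula.Realize, e]

theorem Def.exists_support {α : Type w} {σ : α → L.Sorts} {P : (∀ a, M (σ a)) → Prop}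
    (hP : Def σ P) : ∃ S : Set α, S.Finite ∧ ∃ Q : (∀ a : S, M (σ a)) → Prop,
      Def (fun a : S => σ a) Q ∧ ∀ v, P v ↔ Q fun a => v a := by
  obtain ⟨φ, hφ⟩ := hP
  obtain ⟨S, hS, h⟩ := BFormula.exists_support (M := M) φ
  obtain ⟨φ', e⟩ := h S subset_rfl
  exact ⟨S, hS, _, Formula.def φ', fun v => (hφ v).symm.trans (e v _).symm⟩

end

/-! ### Assignments transported along substitutions of variables -/

section Pull

variable {L : SortedLanguage.{u}} {M : L.Sorts → Type u}

/-- The assignment of the variables `α` obtained from an assignment of `β` by a substitution. -/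
def pull {α : Type w} {β : Type w'} {σ : α → L.Sorts} {τ : β → L.Sorts} (f : α → β)
    (h : ∀ a, τ (f a) = σ a) (v : ∀ b, M (τ b)) (a : α) : M (σ a) :=
  cast (congrArg M (h a)) (v (f a))

theorem pull_spec {α : Type w} {β : Type w'} {σ : α → L.Sorts} {τ : β → L.Sorts} (f : α → β)
    (h : ∀ a, τ (f a) = σ a) (v : ∀ b, M (τ b)) (a : α) :
    (⟨τ (f a), v (f a)⟩ : Elem M) = ⟨σ a, pull f h v a⟩ :=
  Sigma.ext (h a) (cast_heq _ _).symm

end Pull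

variable {L : SortedLanguage.{u}} {M : L.Sorts → Type u} [L.Structure M]

theorem Def.pull {α : Type w} {β : Type w'} {σ : α → L.Sorts} {τ : β → L.Sorts}
    {Q : (∀ a, M (σ a)) → Prop} (hQ : Def σ Q) (f : α → β) (h : ∀ a, τ (f a) = σ a) :
    Def τ fun v => Q (pull f h v) :=
  hQ.comap f h fun v => ⟨_, pull_spec f h v, Iff.rfl⟩

/-- Renaming of variables that respects the sorts definitionally. -/
theorem Def.rename {α : Type w} {β : Type w'} {τ : β → L.Sorts} (f : α → β)
    {Q : (∀ a, M (τ (f a))) → Prop} (hQ : Def (fun a => τ (f a)) Q) :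
    Def τ fun v => Q (fun a => v (f a)) :=
  hQ.comap f (fun _ => rfl) fun _ => ⟨_, fun _ => rfl, Iff.rfl⟩

/-! ### Definability with parameters -/

/-- The predicate `P` is defined by a formula with parameters from `C`. -/
def DefOver {α : Type w} (C : Set (Elem M)) (σ : α → L.Sorts) (P : (∀ a, M (σ a)) → Prop) :
    Prop :=
  ∃ Q, Def (Sum.elim σ fun c : C => c.1.1) Q ∧
    ∀ v, P v ↔ Q (join (τ := fun c : C => c.1.1) v fun c : C => c.1.2)

section DefOver

variable {α : Type w} {σ : α → L.Sorts} {C D : Set (Elem M)}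

theorem defOver_iff {P : (∀ a, M (σ a)) → Prop} :
    DefOver C σ P ↔ ∃ φ : FormulaOver σ C, ∀ v, HoldsOver φ v ↔ P v := by
  constructor
  · rintro ⟨Q, ⟨φ, hφ⟩, hQ⟩
    exact ⟨φ, fun v => (hφ _).trans (hQ v).symm⟩
  · rintro ⟨φ, hφ⟩
    exact ⟨_, Formula.def φ, fun v => (hφ v).symm⟩

theorem DefOver.of_tuple {β : Type w'} {τ : β → L.Sorts} {c : ∀ i, M (τ i)} (hc : TupleIn c C)
    {Q : (∀ x, M (Sum.elim σ τ x)) → Prop} (hQ : Def (Sum.elim σ τ) Q) :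
    DefOver C σ fun v => Q (join v c) := by
  let f : α ⊕ β → α ⊕ C := Sum.map id fun i => ⟨_, hc i⟩
  have hf : ∀ x, Sum.elim σ (fun c : C => c.1.1) (f x) = Sum.elim σ τ x := by
    rintro (a | i) <;> rfl
  refine ⟨_, hQ.pull f hf, fun v => ?_⟩
  have : join v c = SortedLanguage.pull f hf
      (join (τ := fun c : C => c.1.1) v fun c : C => c.1.2) := by
    funext x
    rcases x with a | i <;> rfl
  exact iff_of_eq (congrArg Q this)

/-- A formula mentions only finitely many of its parameters; enumerating them turns definability
over a set into a parameter-free predicate evaluated at a finite tuple. -/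
theorem DefOver.exists_tuple {P : (∀ a, M (σ a)) → Prop} (hP : DefOver C σ P) :
    ∃ (n : ℕ) (τ : Fin n → L.Sorts) (c : ∀ i, M (τ i)), TupleIn c C ∧
      ∃ Q, Def (Sum.elim σ τ) Q ∧ ∀ v, P v ↔ Q (join v c) := by
  obtain ⟨Q, hQ, hPQ⟩ := hP
  obtain ⟨S, hS, Q', hQ', e⟩ := hQ.exists_support
  have hT : {c : C | Sum.inr c ∈ S}.Finite := hS.preimage Sum.inr_injective.injOn
  have := hT.to_subtype
  obtain ⟨n, ⟨g⟩⟩ := Finite.exists_equiv_fin {c : C | Sum.inr c ∈ S}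
  let τ : Fin n → L.Sorts := fun i => (g.symm i).1.1.1
  let c : ∀ i, M (τ i) := fun i => (g.symm i).1.1.2
  let f : S → α ⊕ Fin n := fun x => match x with
    | ⟨.inl a, _⟩ => .inl a
    | ⟨.inr c, h⟩ => .inr (g ⟨c, h⟩)
  have hf : ∀ x : S, Sum.elim σ τ (f x) = Sum.elim σ (fun c : C => c.1.1) x := by
    rintro ⟨a | c, h⟩
    · rfl
    · simp [f, τ]
  refine ⟨n, τ, c, fun i => (g.symm i).1.2, _, hQ'.pull f hf, fun v => ?_⟩
  rw [hPQ, e]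
  refine iff_of_eq (congrArg Q' ?_)
  funext x
  have h₁ := pull_spec f hf (join v c) x
  have h₂ : (⟨Sum.elim σ τ (f x), join v c (f x)⟩ : Elem M) =
      ⟨Sum.elim σ (fun c : C => c.1.1) x,
        join (τ := fun c : C => c.1.1) v (fun c : C => c.1.2) x⟩ := by
    rcases x with ⟨a | d, h⟩
    · rfl
    · change (g.symm (g ⟨d, h⟩)).1.1 = d.1
      rw [Equiv.symm_apply_apply]
  simpa using h₂.symm.trans h₁

theorem DefOver.mono (h : C ⊆ D) {P : (∀ a, M (σ a)) → Prop} (hP : DefOver C σ P) :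
    DefOver D σ P := by
  obtain ⟨n, τ, c, hc, Q, hQ, e⟩ := hP.exists_tuple
  obtain ⟨Q', hQ', e'⟩ := DefOver.of_tuple (fun i => h (hc i)) hQ
  exact ⟨Q', hQ', fun v => (e v).trans (e' v)⟩

theorem DefOver.congr {P P' : (∀ a, M (σ a)) → Prop} (hP : DefOver C σ P)
    (h : ∀ v, P' v ↔ P v) : DefOver C σ P' := by
  obtain ⟨Q, hQ, e⟩ := hP
  exact ⟨Q, hQ, fun v => (h v).trans (e v)⟩

theorem DefOver.and {P P' : (∀ a, M (σ a)) → Prop} (hP : DefOver C σ P) (hP' : DefOver C σ P') :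
    DefOver C σ fun v => P v ∧ P' v := by
  obtain ⟨Q, hQ, e⟩ := hP
  obtain ⟨Q', hQ', e'⟩ := hP'
  exact ⟨_, hQ.and hQ', fun v => and_congr (e v) (e' v)⟩

theorem DefOver.not {P : (∀ a, M (σ a)) → Prop} (hP : DefOver C σ P) :
    DefOver C σ fun v => ¬ P v := by
  obtain ⟨Q, hQ, e⟩ := hP
  exact ⟨_, hQ.not, fun v => not_congr (e v)⟩

theorem DefOver.forall_finite {ι : Type} [Finite ι] {P : ι → (∀ a, M (σ a)) → Prop}
    (hP : ∀ i, DefOver C σ (P i)) : DefOver C σ fun v => ∀ i, P i v := by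
  choose Q hQ e using hP
  exact ⟨_, Def.forall_finite hQ, fun v => forall_congr' fun i => e i v⟩

theorem Def.defOver {P : (∀ a, M (σ a)) → Prop} (hP : Def σ P) :
    DefOver C σ P :=
  ⟨_, Def.rename (τ := Sum.elim σ fun c : C => c.1.1) Sum.inl hP, fun _ => Iff.rfl⟩

theorem DefOver.rename {β : Type w'} {τ : β → L.Sorts} (f : α → β)
    {P : (∀ a, M (τ (f a))) → Prop} (hP : DefOver C (fun a => τ (f a)) P) :
    DefOver C τ fun v => P (fun a => v (f a)) := by
  obtain ⟨n, τ', c, hc, Q, hQ, e⟩ := hP.exists_tuple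
  let g : α ⊕ Fin n → β ⊕ Fin n := Sum.map f id
  have hg : ∀ x, Sum.elim τ τ' (g x) = Sum.elim (fun a => τ (f a)) τ' x := by
    rintro (a | i) <;> rfl
  refine (DefOver.of_tuple hc (hQ.pull g hg)).congr fun v => (e _).trans ?_
  refine iff_of_eq (congrArg Q ?_)
  funext x
  rcases x with a | i <;> rfl

theorem DefOver.ex_tuple {n : ℕ} {τ : Fin n → L.Sorts} {P : (∀ c, M (Sum.elim σ τ c)) → Prop}
    (hP : DefOver C (Sum.elim σ τ) P) :
    DefOver C σ fun v => ∃ y : ∀ i, M (τ i), P (join v y) := by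
  obtain ⟨m, τ', c, hc, Q, hQ, e⟩ := hP.exists_tuple
  let g : (α ⊕ Fin n) ⊕ Fin m → (α ⊕ Fin m) ⊕ Fin n :=
    Sum.elim (Sum.elim (fun a => .inl (.inl a)) .inr) fun i => .inl (.inr i)
  have hg : ∀ x, Sum.elim (Sum.elim σ τ') τ (g x) = Sum.elim (Sum.elim σ τ) τ' x := by
    rintro ((a | i) | i) <;> rfl
  refine (DefOver.of_tuple hc (hQ.pull g hg).ex_tuple).congr fun v => ?_
  refine exists_congr fun y => (e _).trans (iff_of_eq (congrArg Q ?_))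
  funext x
  rcases x with (a | i) | i <;> rfl

theorem defOver_eq {e : Elem M} (he : e ∈ C) :
    DefOver C (fun _ : Unit => e.1) fun v => v () = e.2 := by
  refine (DefOver.of_tuple (β := Unit) (τ := fun _ => e.1) (c := fun _ => e.2) (fun _ => he)
    (Def.eq_var (σ := Sum.elim (fun _ : Unit => e.1) fun _ : Unit => e.1)
      (.inl ()) (.inr ()))).congr fun v => ?_
  change _ ↔ (⟨e.1, v ()⟩ : Elem M) = ⟨e.1, e.2⟩
  rw [Sigma.mk.injEq]
  simp

end DefOver

/-! ### Algebraic closure -/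

section Acl

variable {C D : Set (Elem M)}

theorem mem_acl_iff {e : Elem M} : e ∈ acl C ↔ ∃ P, DefOver C (fun _ : Unit => e.1) P ∧
    P (fun _ => e.2) ∧ {x : M e.1 | P fun _ => x}.Finite := by
  constructor
  · rintro ⟨φ, h, hfin⟩
    exact ⟨_, defOver_iff.2 ⟨φ, fun _ => Iff.rfl⟩, h, hfin⟩
  · rintro ⟨P, hP, h, hfin⟩
    obtain ⟨φ, hφ⟩ := defOver_iff.1 hP
    exact ⟨φ, (hφ _).2 h, by simpa only [hφ] using hfin⟩

theorem finite_of_forall_not_injective {X : Type u} {S : Set X} {k : ℕ}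
    (h : ∀ x : Fin k → X, Function.Injective x → ¬ ∀ i, x i ∈ S) : S.Finite := by
  by_contra hS
  have : Infinite S := Set.infinite_coe_iff.2 hS
  let g := Infinite.natEmbedding S
  exact h (fun i => g i) (fun i j hij => Fin.ext (g.injective (Subtype.ext hij))) fun i => (g i).2

/-- "There are fewer than `k` solutions" is itself expressible in the parameters. Conjoining it to
an algebraic formula makes the bound valid for every choice of parameters. -/
theorem exists_uniform_of_mem_acl {e : Elem M} (he : e ∈ acl C) :
    ∃ (n : ℕ) (τ : Fin n → L.Sorts) (c : ∀ i, M (τ i)), TupleIn c C ∧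
      ∃ Q, Def (Sum.elim (fun _ : Unit => e.1) τ) Q ∧ Q (join (fun _ => e.2) c) ∧
        ∃ k : ℕ, ∀ (y : ∀ i, M (τ i)) (x : Fin k → M e.1), Function.Injective x →
          ¬ ∀ i, Q (join (fun _ => x i) y) := by
  obtain ⟨P, hP, h, hfin⟩ := mem_acl_iff.1 he
  obtain ⟨n, τ, c, hc, Q, hQ, hPQ⟩ := hP.exists_tuple
  -- One more than the number of solutions at `c`, hence also positive.
  set k := {x : M e.1 | P fun _ => x}.ncard + 1
  have hmany : Def (M := M) (Sum.elim (fun _ : Unit => e.1) τ) fun v =>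
      ∃ x : Fin k → M e.1, (∀ p : {p : Fin k × Fin k // p.1 ≠ p.2}, x p.1.1 ≠ x p.1.2) ∧
        ∀ i, Q (join (fun _ => x i) fun j => v (.inr j)) := by
    have h₁ : Def (M := M) (Sum.elim (Sum.elim (fun _ : Unit => e.1) τ) fun _ : Fin k => e.1)
        fun z => (∀ p : {p : Fin k × Fin k // p.1 ≠ p.2}, z (.inr p.1.1) ≠ z (.inr p.1.2)) ∧
          ∀ i, Q (join (fun _ => z (.inr i)) fun j => z (.inl (.inr j))) := by
      refine (Def.forall_finite fun p => ?_).and (Def.forall_finite fun i => ?_)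
      · refine (Def.eq_var (.inr p.1.1) (.inr p.1.2)).not.congr fun v => ?_
        exact not_congr ⟨congrArg (Sigma.mk e.1), fun h => eq_of_heq (Sigma.mk.inj h).2⟩
      · refine hQ.comap (Sum.elim (fun _ => .inr i) fun j => .inl (.inr j)) ?_
          fun z => ⟨_, ?_, Iff.rfl⟩
        · rintro (_ | j) <;> rfl
        · rintro (_ | j) <;> rfl
    exact h₁.ex_tuple
  refine ⟨n, τ, c, hc, _, hQ.and hmany.not, ⟨(hPQ _).1 h, ?_⟩, k, ?_⟩
  · rintro ⟨x, hx, hxQ⟩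
    have hinj : Function.Injective x := fun i j hij => by
      by_contra hne
      exact hx ⟨(i, j), hne⟩ hij
    have hsub : Set.range x ⊆ {x : M e.1 | P fun _ => x} := by
      rintro _ ⟨i, rfl⟩
      exact (hPQ _).2 (hxQ i)
    have := Set.ncard_le_ncard hsub hfin
    rw [← Set.image_univ, Set.ncard_image_of_injective _ hinj] at this
    simp [k] at this
  · intro y x hx hall
    have hk : 0 < k := Nat.succ_pos _
    -- The conjunct denying `k` distinct solutions does not depend on the solution, so a single
    -- index, available since `k > 0`, gives the contradiction.
    refine (hall ⟨0, hk⟩).2 ⟨x, fun p => hx.ne p.2, fun i => (hall i).1⟩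

theorem mem_acl_of_tuple {β : Type w} {τ : β → L.Sorts} {c : ∀ i, M (τ i)} (hc : TupleIn c C)
    {e : Elem M} {Q : (∀ x, M (Sum.elim (fun _ : Unit => e.1) τ x)) → Prop}
    (hQ : Def (Sum.elim (fun _ : Unit => e.1) τ) Q) (h : Q (join (fun _ => e.2) c))
    (hfin : {x : M e.1 | Q (join (fun _ => x) c)}.Finite) : e ∈ acl C :=
  mem_acl_iff.2 ⟨_, DefOver.of_tuple hc hQ, h, hfin⟩

theorem acl_mono (h : C ⊆ D) : acl C ⊆ acl D := fun e he => by
  obtain ⟨P, hP, h'⟩ := mem_acl_iff.1 he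
  exact mem_acl_iff.2 ⟨P, hP.mono h, h'⟩

theorem subset_acl (C : Set (Elem M)) : C ⊆ acl C := fun e he =>
  mem_acl_iff.2 ⟨_, defOver_eq he, rfl, by simp⟩

/-- Quantify the intermediate parameters out, each restricted to a finite set defined over `C`; the
solution set is then a finite union of uniformly bounded sets. -/
theorem acl_acl (C : Set (Elem M)) : acl (acl C) = acl C := by
  refine Set.Subset.antisymm (fun e he => ?_) (subset_acl _)
  obtain ⟨n, τ, c, hc, Q, hQ, hQc, k, hk⟩ := exists_uniform_of_mem_acl he
  choose R hR hRc hRfin using fun i => mem_acl_iff.1 (hc i)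
  refine mem_acl_iff.2 ⟨fun v => ∃ y : ∀ i, M (τ i),
    (∀ i, R i fun _ => y i) ∧ Q (join v y), ?_, ⟨c, hRc, hQc⟩, ?_⟩
  · exact (DefOver.ex_tuple (P := fun z => (∀ i, R i fun _ => z (.inr i)) ∧ Q z)
      ((DefOver.forall_finite fun i => DefOver.rename (fun _ : Unit => .inr i) (hR i)).and
        hQ.defOver))
  · have hpi : {y : ∀ i, M (τ i) | ∀ i, R i fun _ => y i}.Finite := by
      have := Set.Finite.pi hRfin
      exact this.subset fun y hy => by
        rw [Set.mem_univ_pi]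
        exact hy
    refine (hpi.biUnion fun y _ =>
      finite_of_forall_not_injective (S := {x | Q (join (fun _ => x) y)}) (hk y)).subset ?_
    rintro x ⟨y, hy, hx⟩
    exact Set.mem_biUnion hy hx

theorem acl_subset_acl (h : C ⊆ acl D) : acl C ⊆ acl D :=
  (acl_mono h).trans (acl_acl D).subset

end Acl

/-- A non-algebraic type over a small set has infinitely many realisations. -/
theorem infinite_realisations {κ : Cardinal.{u}} (hM : IsBigModel M κ) {C : Set (Elem M)}
    (hC : IsSmall κ C) {s : L.Sorts} {x : M s} (hx : (⟨s, x⟩ : Elem M) ∉ acl C) :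
    {y : M s | ∀ P, DefOver C (fun _ : Unit => s) P → P (fun _ => x) →
      P fun _ => y}.Infinite := by
  set F := {y : M s | ∀ P, DefOver C (fun _ : Unit => s) P → P (fun _ => x) → P fun _ => y}
  intro hF
  set E : Set (Elem M) := C ∪ Sigma.mk s '' F
  have hE : #E < κ := (mk_union_le _ _).trans_lt (add_lt_of_lt hM.aleph0_lt.le hC
    ((lt_aleph0_iff_set_finite.2 (hF.image _)).trans hM.aleph0_lt))
  -- If `F` were finite, the type of `x` over `C` together with "not in `F`" would still be finitely
  -- satisfiable. `p` collects the formulas that follow from one `C`-formula true of `x` outside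
  -- `F`.
  let p : Set (FormulaOver (fun _ : Unit => s) E) := {φ | ∃ P, DefOver C (fun _ : Unit => s) P ∧
    P (fun _ => x) ∧ ∀ y ∉ F, P (fun _ => y) → HoldsOver φ fun _ => y}
  obtain ⟨y, hy⟩ := hM.saturated E hE s p fun q hq hfin => by
    have := hfin.to_subtype
    obtain ⟨n, ⟨g⟩⟩ := Finite.exists_equiv_fin q
    choose P hP hPx hPφ using fun φ : q => hq φ.2
    -- A finite conjunction of `C`-formulas true of `x` has infinitely many solutions, as `x` is not
    -- algebraic, so one lies outside `F`.
    have hinf : {y : M s | ∀ i, P (g.symm i) fun _ => y}.Infinite := fun hfin =>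
      hx (mem_acl_iff.2 ⟨_, DefOver.forall_finite fun i => hP (g.symm i), fun i => hPx _, hfin⟩)
    obtain ⟨y, hy, hyF⟩ := (hinf.sdiff hF).nonempty
    refine ⟨y, fun φ hφ => hPφ ⟨φ, hφ⟩ y hyF ?_⟩
    simpa using hy (g ⟨φ, hφ⟩)
  have hyF : y ∈ F := fun P hP hPx => by
    obtain ⟨φ, hφ⟩ := defOver_iff.1 (hP.mono (Set.subset_union_left (t := Sigma.mk s '' F)))
    exact (hφ _).1 (hy φ ⟨P, hP, hPx, fun z _ hz => (hφ _).2 hz⟩)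
  obtain ⟨φ, hφ⟩ := defOver_iff.1
    (defOver_eq (e := ⟨s, y⟩) (C := E) (Or.inr ⟨y, hyF, rfl⟩)).not
  -- The realisation `y` lies in `F`, yet "different from `y`" belongs to `p`, with a trivially true
  -- `C`-formula as witness.
  refine (hφ _).1 (hy φ ⟨fun v => v = v, ?_, rfl, fun z hz _ => (hφ _).2 ?_⟩) rfl
  · exact (Def.false.not.congr fun v => by simp).defOver
  · rintro rfl
    exact hz hyF

/-! ### Counting formulas -/

theorem mk_sigma_le {ι : Type u} {f : ι → Type u} {μ : Cardinal.{u}} (hμ : ℵ₀ ≤ μ) (hι : #ι ≤ μ)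
    (hf : ∀ i, #(f i) ≤ μ) : #(Σ i, f i) ≤ μ := by
  rw [mk_sigma]
  calc sum (fun i => #(f i)) ≤ sum fun _ : ι => μ := sum_le_sum _ _ hf
    _ = #ι * μ := sum_const' _ _
    _ ≤ μ * μ := mul_le_mul_left hι μ
    _ = μ := mul_eq_self hμ

/-- The tree of symbols of a term. -/
def Term.tree {α : Type u} {σ : α → L.Sorts} : ∀ {s : L.Sorts}, L.Term σ s →
    WType fun a : α ⊕ L.Fn => Fin (Sum.elim (fun _ => 0) (fun f => (L.dom f).length) a)
  | _, .var a => ⟨.inl a, fun i => i.elim0⟩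
  | _, .func f ts => ⟨.inr f, fun i => (ts i).tree⟩

/-- The symbol at the root determines the sort, so equality of trees gives equality in the sigma
type; the cardinality bound for well-founded trees then counts terms. -/
theorem Term.tree_injective {α : Type u} {σ : α → L.Sorts} {s : L.Sorts} (t : L.Term σ s) :
    ∀ {s' : L.Sorts} (t' : L.Term σ s'), t.tree = t'.tree →
      (⟨s, t⟩ : Σ s, L.Term σ s) = ⟨s', t'⟩ := by
  induction t with
  | var a =>
    rintro s' (b | ⟨g, ts'⟩) h
    · simp only [Term.tree, WType.mk.injEq, Sum.inl.injEq] at h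
      obtain ⟨rfl, -⟩ := h
      rfl
    · exact nomatch (WType.mk.inj h).1
  | func f ts ih =>
    rintro s' (b | ⟨g, ts'⟩) h
    · exact nomatch (WType.mk.inj h).1
    · simp only [Term.tree, WType.mk.injEq, Sum.inr.injEq] at h
      obtain ⟨rfl, h⟩ := h
      have h' := eq_of_heq h
      have : ts = ts' := by
        funext i
        simpa using ih i (ts' i) (congrFun h' i)
      rw [this]

theorem Term.mk_sigma_le {α : Type u} {σ : α → L.Sorts} {μ : Cardinal.{u}} (hμ : ℵ₀ ≤ μ)
    (hL : L.card ≤ μ) (hα : #α ≤ μ) : #(Σ s, L.Term σ s) ≤ μ := by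
  have hinj : Function.Injective fun t : Σ s, L.Term σ s => t.2.tree := by
    rintro ⟨s, t⟩ ⟨s', t'⟩ h
    exact t.tree_injective t' h
  refine (mk_le_of_injective hinj).trans
    (WType.cardinalMk_le_max_aleph0_of_finite'.trans (max_le ?_ hμ))
  rw [lift_uzero, mk_sum, lift_id, lift_id]
  exact add_le_of_le hμ hα ((self_le_add_left _ _).trans ((self_le_add_right _ _).trans hL))

/-- The labels of the nodes in the tree of a formula. -/
abbrev FormulaLabel {α : Type u} (σ : α → L.Sorts) : Type u :=
  List L.Sorts ⊕ (Σ Γ : List L.Sorts, (Σ s, L.Term (ctx σ Γ) s) × (Σ s, L.Term (ctx σ Γ) s)) ⊕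
    (Σ Γ : List L.Sorts, L.Rel × List (Σ s, L.Term (ctx σ Γ) s)) ⊕ PUnit.{u + 1} ⊕ L.Sorts

/-- The number of successors of a node in the tree of a formula. -/
def FormulaLabel.arity {α : Type u} {σ : α → L.Sorts} : FormulaLabel σ → ℕ
  | .inr (.inr (.inr (.inl _))) => 2
  | .inr (.inr (.inr (.inr _))) => 1
  | _ => 0

/-- The tree of a formula. -/
def BFormula.tree {α : Type u} {σ : α → L.Sorts} : ∀ {Γ : List L.Sorts}, L.BFormula σ Γ →
    WType fun a : FormulaLabel σ => Fin a.arity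
  | Γ, .falsum => ⟨.inl Γ, fun i => i.elim0⟩
  | Γ, .equal t₁ t₂ => ⟨.inr (.inl ⟨Γ, ⟨_, t₁⟩, ⟨_, t₂⟩⟩), fun i => i.elim0⟩
  | Γ, .rel R ts => ⟨.inr (.inr (.inl ⟨Γ, R, List.ofFn fun i => ⟨_, ts i⟩⟩)), fun i => i.elim0⟩
  | _, .imp φ ψ => ⟨.inr (.inr (.inr (.inl ⟨⟩))), ![φ.tree, ψ.tree]⟩
  | _, .all s φ => ⟨.inr (.inr (.inr (.inr s))), fun _ => φ.tree⟩

/-- The leaves record their contexts, and the contexts of inner nodes are recovered from their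
children. -/
theorem BFormula.tree_injective {α : Type u} {σ : α → L.Sorts} {Γ : List L.Sorts}
    (φ : L.BFormula σ Γ) : ∀ {Δ : List L.Sorts} (ψ : L.BFormula σ Δ), φ.tree = ψ.tree →
      (⟨Γ, φ⟩ : Σ Γ, L.BFormula σ Γ) = ⟨Δ, ψ⟩ := by
  induction φ with
  | falsum =>
    rintro Δ (_ | ⟨t₁', t₂'⟩ | ⟨R', ts'⟩ | ⟨φ', ψ'⟩ | ⟨s', φ'⟩) h <;>
      have h₀ := (WType.mk.inj h).1 <;> first | (cases h₀; done) | have h₁ := (WType.mk.inj h).2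
    obtain rfl := Sum.inl.inj h₀
    rfl
  | equal t₁ t₂ =>
    rintro Δ (_ | ⟨t₁', t₂'⟩ | ⟨R', ts'⟩ | ⟨φ', ψ'⟩ | ⟨s', φ'⟩) h <;>
      have h₀ := (WType.mk.inj h).1 <;> first | (cases h₀; done) | have h₁ := (WType.mk.inj h).2
    cases h₀
    rfl
  | rel R ts =>
    rintro Δ (_ | ⟨t₁', t₂'⟩ | ⟨R', ts'⟩ | ⟨φ', ψ'⟩ | ⟨s', φ'⟩) h <;>
      have h₀ := (WType.mk.inj h).1 <;> first | (cases h₀; done) | have h₁ := (WType.mk.inj h).2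
    obtain ⟨rfl, h⟩ := Sigma.mk.inj (Sum.inl.inj (Sum.inr.inj (Sum.inr.inj h₀)))
    obtain ⟨rfl, h⟩ := Prod.mk.inj (eq_of_heq h)
    have : ts = ts' := by
      funext i
      simpa using congrFun (List.ofFn_injective h) i
    rw [this]
  | imp φ ψ ih₁ ih₂ =>
    rintro Δ (_ | ⟨t₁', t₂'⟩ | ⟨R', ts'⟩ | ⟨φ', ψ'⟩ | ⟨s', φ'⟩) h <;>
      have h₀ := (WType.mk.inj h).1 <;> first | (cases h₀; done) | have h₁ := (WType.mk.inj h).2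
    have h' := eq_of_heq h₁
    obtain ⟨rfl, e₁⟩ := Sigma.mk.inj (ih₁ φ' (congrFun h' (0 : Fin 2)))
    obtain ⟨-, e₂⟩ := Sigma.mk.inj (ih₂ ψ' (congrFun h' (1 : Fin 2)))
    rw [eq_of_heq e₁, eq_of_heq e₂]
  | all s φ ih =>
    rintro Δ (_ | ⟨t₁', t₂'⟩ | ⟨R', ts'⟩ | ⟨φ', ψ'⟩ | ⟨s', φ'⟩) h <;>
      have h₀ := (WType.mk.inj h).1 <;> first | (cases h₀; done) | have h₁ := (WType.mk.inj h).2
    obtain rfl := Sum.inr.inj (Sum.inr.inj (Sum.inr.inj (Sum.inr.inj h₀)))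
    obtain ⟨h₂, e⟩ := Sigma.mk.inj (ih φ' (congrFun (eq_of_heq h₁) (0 : Fin 1)))
    obtain ⟨-, rfl⟩ := List.cons.inj h₂
    rw [eq_of_heq e]

theorem Formula.mk_le {α : Type u} {σ : α → L.Sorts} {μ : Cardinal.{u}} (hμ : ℵ₀ ≤ μ)
    (hL : L.card ≤ μ) (hα : #α ≤ μ) : #(L.Formula σ) ≤ μ := by
  have hinj : Function.Injective fun φ : L.Formula σ => φ.tree := fun φ ψ h => by
    simpa using φ.tree_injective ψ h
  have hS : #L.Sorts ≤ μ := (self_le_add_right _ _).trans ((self_le_add_right _ _).trans hL)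
  have hR : #L.Rel ≤ μ := (self_le_add_left _ _).trans hL
  have hlist : ∀ {X : Type u}, #X ≤ μ → #(List X) ≤ μ := fun h =>
    (mk_list_le_max _).trans (max_le hμ h)
  have hT : ∀ Γ : List L.Sorts, #(Σ s, L.Term (ctx σ Γ) s) ≤ μ := fun Γ =>
    Term.mk_sigma_le hμ hL (by
      rw [mk_sum, lift_uzero]
      exact add_le_of_le hμ hα ((lift_lt_aleph0.2 (mk_lt_aleph0)).le.trans hμ))
  have hmul : ∀ {X Y : Type u}, #X ≤ μ → #Y ≤ μ → #(X × Y) ≤ μ := fun hX hY => by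
    rw [mk_prod, lift_id, lift_id]
    exact (mul_le_mul' hX hY).trans (mul_eq_self hμ).le
  have hadd : ∀ {X Y : Type u}, #X ≤ μ → #Y ≤ μ → #(X ⊕ Y) ≤ μ := fun hX hY => by
    rw [mk_sum, lift_id, lift_id]
    exact add_le_of_le hμ hX hY
  refine (mk_le_of_injective hinj).trans
    (WType.cardinalMk_le_max_aleph0_of_finite'.trans (max_le ?_ hμ))
  rw [lift_uzero]
  refine hadd (hlist hS) (hadd (SortedLanguage.mk_sigma_le hμ (hlist hS) fun Γ =>
    hmul (hT Γ) (hT Γ)) (hadd (SortedLanguage.mk_sigma_le hμ (hlist hS) fun Γ =>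
      hmul hR (hlist (hT Γ))) (hadd (mk_lt_aleph0.le.trans hμ) hS)))

/-- The closure is covered by the finite solution sets of formulas over `C`, and there are at most
`max(ℵ₀, |L|, |C|)` such formulas. -/
theorem isSmall_acl {κ : Cardinal.{u}} (h₀ : ℵ₀ < κ) (hL : L.card < κ) {C : Set (Elem M)}
    (hC : IsSmall κ C) : IsSmall κ (acl C) := by
  set μ := max ℵ₀ (max L.card #C)
  have hμ : ℵ₀ ≤ μ := le_max_left _ _
  have hLμ : L.card ≤ μ := (le_max_left _ _).trans (le_max_right _ _)
  have hCμ : #C ≤ μ := (le_max_right _ _).trans (le_max_right _ _)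
  have hS : #L.Sorts ≤ μ := (self_le_add_right _ _).trans ((self_le_add_right _ _).trans hLμ)
  -- The solution set of the formula if that is finite, and the empty set otherwise.
  let T := fun x : Σ s, FormulaOver (fun _ : Unit => s) C =>
    {y : M x.1 | HoldsOver x.2 (fun _ => y) ∧ {y : M x.1 | HoldsOver x.2 fun _ => y}.Finite}
  have hT : ∀ x, (T x).Finite := fun x => by
    by_cases h : {y : M x.1 | HoldsOver x.2 fun _ => y}.Finite
    · exact h.subset fun y hy => hy.1
    · have : T x = ∅ := Set.eq_empty_of_forall_notMem fun y hy => h hy.2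
      rw [this]
      exact Set.finite_empty
  have hle : #(Σ x, T x) ≤ μ := by
    refine mk_sigma_le hμ (mk_sigma_le hμ hS fun s => Formula.mk_le hμ hLμ ?_) fun x =>
      (lt_aleph0_iff_set_finite.2 (hT x)).le.trans hμ
    rw [mk_sum, lift_uzero]
    exact add_le_of_le hμ ((lift_lt_aleph0.2 mk_lt_aleph0).le.trans hμ) (by simpa using hCμ)
  have hsurj : Function.Surjective fun z : Σ x, T x =>
      (⟨⟨z.1.1, z.2.1⟩, z.1.2, z.2.2.1, z.2.2.2⟩ : acl C) := by
    rintro ⟨⟨s, y⟩, φ, h, hfin⟩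
    exact ⟨⟨⟨s, φ⟩, ⟨y, h, hfin⟩⟩, rfl⟩
  exact ((mk_le_of_surjective hsurj).trans hle).trans_lt (max_lt h₀ (max_lt hL hC))

/-! ### Dividing for pairs in `Ξ_M` -/

open Classical in
/-- A single variable `u` of a definable predicate can be separated from the other ones. -/
theorem Def.exists_split {X : Type w} {Y : Type w'} {sx : X → L.Sorts} {sy : Y → L.Sorts}
    {Q : (∀ c, M (Sum.elim sx sy c)) → Prop} (hQ : Def (Sum.elim sx sy) Q) (u : Y) :
    ∃ Q', Def (Sum.elim (fun _ : Unit => sy u) (Sum.elim sx fun y : {y // y ≠ u} => sy y)) Q' ∧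
      ∀ (x : M (sy u)) (a : ∀ i, M (sx i)) (b : ∀ y, M (sy y)),
        Q' (join (fun _ => x) (join a fun y : {y // y ≠ u} => b y)) ↔
          Q (join a (Function.update b u x)) := by
  let f : X ⊕ Y → Unit ⊕ (X ⊕ {y // y ≠ u}) :=
    Sum.elim (fun i => .inr (.inl i))
      fun y => if h : y = u then .inl () else .inr (.inr ⟨y, h⟩)
  have hf : ∀ c, Sum.elim (fun _ : Unit => sy u) (Sum.elim sx fun y : {y // y ≠ u} => sy y) (f c) =
      Sum.elim sx sy c := by
    rintro (i | y)
    · rfl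
    · by_cases h : y = u
      · simp [f, h]
      · simp [f, h]
  refine ⟨_, hQ.pull f hf, fun x a b => iff_of_eq (congrArg Q ?_)⟩
  funext c
  have h₁ := pull_spec f hf (join (fun _ => x) (join a fun y : {y // y ≠ u} => b y)) c
  have key : ∀ (d : Unit ⊕ (X ⊕ {y // y ≠ u})), f c = d →
      (⟨Sum.elim (fun _ : Unit => sy u) (Sum.elim sx fun y : {y // y ≠ u} => sy y) d,
        join (fun _ => x) (join a fun y : {y // y ≠ u} => b y) d⟩ : Elem M) =
      ⟨Sum.elim sx sy c, join a (Function.update b u x) c⟩ := by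
    rintro d rfl
    rcases c with i | y
    · rfl
    · by_cases h : y = u
      · subst h
        have : f (.inr y) = .inl () := by simp [f]
        rw [this]
        change (⟨sy y, x⟩ : Elem M) = ⟨sy y, Function.update b y x y⟩
        rw [Function.update_self]
      · have : f (.inr y) = .inr (.inr ⟨y, h⟩) := by simp [f, h]
        rw [this]
        change (⟨sy y, b y⟩ : Elem M) = ⟨sy y, Function.update b u x y⟩
        rw [Function.update_of_ne h]
  simpa using h₁.symm.trans (key _ rfl)

/-- The entries of a tuple other than the one at `u`. -/
def entriesNe {Y : Type w} {sy : Y → L.Sorts} (a : ∀ y, M (sy y)) (u : Y) : Set (Elem M) :=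
  {e | ∃ y, y ≠ u ∧ e = ⟨sy y, a y⟩}

theorem realisesType_iff {α : Type w} {σ : α → L.Sorts} {C : Set (Elem M)} {v v' : ∀ a, M (σ a)} :
    RealisesType C v v' ↔ ∀ P, DefOver C σ P → P v → P v' := by
  constructor
  · intro h P hP hv
    obtain ⟨φ, hφ⟩ := defOver_iff.1 hP
    exact (hφ v').1 (h φ ((hφ v).2 hv))
  · exact fun h φ => h _ (defOver_iff.2 ⟨φ, fun _ => Iff.rfl⟩)

open Classical in
-- A condition on the whole tuple over `C` is a condition on its `u`-entry over `C` and the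
-- remaining entries.
theorem realisesType_update {Y : Type w} {sy : Y → L.Sorts} {C : Set (Elem M)}
    {a : ∀ y, M (sy y)} {u : Y} {x : M (sy u)}
    (hx : ∀ P, DefOver (C ∪ entriesNe a u) (fun _ : Unit => sy u) P → P (fun _ => a u) →
      P fun _ => x) : RealisesType C a (Function.update a u x) := by
  refine realisesType_iff.2 fun P hP ha => ?_
  obtain ⟨n, τ, c, hc, Q, hQ, hPQ⟩ := hP.exists_tuple
  have hswap : ∀ z, Sum.elim τ sy (Sum.swap z) = Sum.elim sy τ z := by rintro (y | i) <;> rfl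
  obtain ⟨Q', hQ', e⟩ := (hQ.pull Sum.swap hswap).exists_split u
  have hpull : ∀ b, pull Sum.swap hswap (join c b) = join b c := fun b => by
    funext z
    rcases z with y | i <;> rfl
  have hd : TupleIn (join c fun y : {y // y ≠ u} => a y) (C ∪ entriesNe a u) := by
    rintro (i | y)
    · exact Or.inl (hc i)
    · exact Or.inr ⟨y, y.2, rfl⟩
  have := hx _ (DefOver.of_tuple hd hQ')
  simp only [e, hpull, ← hPQ, Function.update_eq_self] at this
  exact this ha

open Classical in
-- Infinitely many realisations of the type of `a_u` over `C` and the other entries, substituted one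
-- at a time, form a dividing sequence.
theorem formulaDivides_of_notMem_acl {κ : Cardinal.{u}} (hM : IsBigModel M κ)
    {p : FormulaPair L} (hp : p ∈ Xi M) {u : p.Y} {V : Set p.Y}
    (hψ : ∀ b : Fin p.k → ∀ y, M (p.sy y), p.ψ.Holds (fun q => b q.1 q.2) ↔
      ∀ i j, i < j → b i u ≠ b j u ∧ ∀ v ∈ V, b i v = b j v) (huV : u ∉ V)
    {C : Set (Elem M)} (hC : IsSmall κ C) {a : ∀ y, M (p.sy y)}
    (ha : (⟨p.sy u, a u⟩ : Elem M) ∉ acl (C ∪ entriesNe a u)) : FormulaDivides p C a := by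
  have hE : (entriesNe a u).Finite := by
    have := p.finY
    refine (Set.finite_range fun y => (⟨p.sy y, a y⟩ : Elem M)).subset ?_
    rintro _ ⟨y, -, rfl⟩
    exact ⟨y, rfl⟩
  have hs : IsSmall κ (C ∪ entriesNe a u) := (mk_union_le _ _).trans_lt
    (add_lt_of_lt hM.aleph0_lt.le hC ((lt_aleph0_iff_set_finite.2 hE).trans hM.aleph0_lt))
  have := Set.infinite_coe_iff.2 (infinite_realisations hM hs ha)
  let x := Infinite.natEmbedding {y : M (p.sy u) | ∀ P,
    DefOver (C ∪ entriesNe a u) (fun _ : Unit => p.sy u) P → P (fun _ => a u) → P fun _ => y}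
  refine ⟨hp, fun i => Function.update a u (x i), fun i => realisesType_update (x i).2,
    fun f hf => (hψ fun i => Function.update a u (x (f i))).2 fun i j hij => ⟨?_, fun v hv => ?_⟩⟩
  · simp only [Function.update_self]
    exact fun h => (hf hij).ne (x.injective (Subtype.ext h))
  · have hvu : v ≠ u := fun h => huV (h ▸ hv)
    simp only [Function.update_of_ne hvu]

/-- Along a dividing sequence the `V`-entries are constant and the `u`-entries distinct, and every
term has the type of `a` over `C`. An algebraic formula for `a_u` over the other entries would
therefore have infinitely many solutions at one parameter tuple. -/
theorem FormulaDivides.notMem_acl {p : FormulaPair L} {u : p.Y} {V : Set p.Y}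
    (hV : ∀ y, y = u ∨ y ∈ V)
    (hψ : ∀ b : Fin p.k → ∀ y, M (p.sy y), p.ψ.Holds (fun q => b q.1 q.2) ↔
      ∀ i j, i < j → b i u ≠ b j u ∧ ∀ v ∈ V, b i v = b j v) (hk : 2 ≤ p.k)
    {C : Set (Elem M)} {a : ∀ y, M (p.sy y)} (h : FormulaDivides p C a) :
    u ∉ V ∧ (⟨p.sy u, a u⟩ : Elem M) ∉ acl (C ∪ entriesNe a u) := by
  obtain ⟨-, bs, hbs, hψbs⟩ := h
  have hpair : ∀ i j, i < j → bs i u ≠ bs j u ∧ ∀ v ∈ V, bs i v = bs j v := by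
    intro i j hij
    -- An increasing choice of indices beginning with `i, j`; the first two places exist because `2
    -- ≤ k`.
    let f : Fin p.k → ℕ := fun t => if t.1 = 0 then i else j + t - 1
    have hf : StrictMono f := by
      intro s t hst
      have : s.1 < t.1 := hst
      simp only [f]
      split_ifs <;> omega
    have := (hψ fun t => bs (f t)).1 (hψbs f hf) ⟨0, by omega⟩ ⟨1, by omega⟩ (by simp)
    simpa [f] using this
  have hconst : ∀ i, ∀ v ∈ V, bs i v = bs 0 v := fun i v hv => by
    rcases Nat.eq_zero_or_pos i with rfl | hi
    · rfl
    · exact ((hpair 0 i hi).2 v hv).symm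
  refine ⟨fun hu => (hpair 0 1 one_pos).1 (hconst 1 u hu).symm, fun hacl => ?_⟩
  obtain ⟨n, τ, c, hc, Q, hQ, hQc, k, hk⟩ := exists_uniform_of_mem_acl hacl
  -- `R j` ties the `j`-th parameter to an element of `C` or to a `V`-entry of the tuple. It
  -- therefore has the same value for every term of the sequence, and type equality over `C`
  -- suffices to transfer the formula.
  have hR : ∀ j, ∃ R : (∀ z, M (Sum.elim p.sy τ z)) → Prop, DefOver C (Sum.elim p.sy τ) R ∧
      R (join a c) ∧ ∀ i i' y y', R (join (bs i) y) → R (join (bs i') y') → y j = y' j := by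
    intro j
    rcases hc j with hj | ⟨y₀, hy₀, hj⟩
    · refine ⟨_, DefOver.rename (τ := Sum.elim p.sy τ) (fun _ : Unit => .inr j) (defOver_eq hj),
        rfl, fun i i' y y' h h' => ?_⟩
      exact Eq.trans h (Eq.symm h')
    · refine ⟨_, (Def.eq_var (σ := Sum.elim p.sy τ) (.inr j) (.inl y₀)).defOver, hj, fun i i' y y' h h' => ?_⟩
      have hv : y₀ ∈ V := (hV y₀).resolve_left hy₀
      have h₁ : (⟨τ j, y j⟩ : Elem M) = ⟨p.sy y₀, bs i y₀⟩ := h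
      have h₂ : (⟨τ j, y' j⟩ : Elem M) = ⟨p.sy y₀, bs i' y₀⟩ := h'
      rw [hconst i y₀ hv] at h₁
      rw [hconst i' y₀ hv] at h₂
      exact eq_of_heq (Sigma.mk.inj (h₁.trans h₂.symm)).2
  choose R hR hRa hRbs using hR
  have hQ' : DefOver (M := M) C (Sum.elim p.sy τ)
      fun z => Q (join (fun _ => z (.inl u)) fun j => z (.inr j)) := by
    refine (hQ.comap (Sum.elim (fun _ => .inl u) .inr) ?_ fun z => ⟨_, ?_, Iff.rfl⟩).defOver
    · rintro (_ | j) <;> rfl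
    · rintro (_ | j) <;> rfl
  have hP := (hQ'.and (DefOver.forall_finite hR)).ex_tuple
  choose y hyQ hyR using fun i => realisesType_iff.1 (hbs i) _ hP ⟨c, hQc, hRa⟩
  have hy : ∀ i, y i = y 0 := fun i => funext fun j => hRbs j i 0 _ _ (hyR i j) (hyR 0 j)
  refine hk (y 0) (fun i => bs i u) (fun i i' hi => ?_) fun i => ?_
  · by_contra hne
    rcases lt_or_gt_of_ne (Fin.val_injective.ne hne) with h | h
    · exact (hpair _ _ h).1 hi
    · exact (hpair _ _ h).1 hi.symm
  · rw [← hy i]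
    exact hyQ i

/-- For `k ≤ 1` the condition `ψ` is vacuous, so a solution of `φ` would contradict inconsistency of
the pair. -/
theorem two_le_of_holds {p : FormulaPair L} (hp : p ∈ XiM M) {a : ∀ x, M (p.sx x)}
    {b : ∀ y, M (p.sy y)} (h : p.φ.Holds (join a b)) : 2 ≤ p.k := by
  obtain ⟨hXi, u, V, -, hψ⟩ := hp
  by_contra hk
  refine hXi ⟨a, fun _ => b, fun _ => h, (hψ fun _ => b).2 fun i j hij => ?_⟩
  have : i.1 < j.1 := hij
  omega

/-! ### The relation given by `Ξ_M` -/

open Classical in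
theorem omegaIndep_xiM_of_acl {A B C : Set (Elem M)}
    (h : ∀ D, C ⊆ D → D ⊆ B ∪ C → acl (A ∪ D) ∩ B ⊆ acl D) : OmegaIndep (XiM M) A C B := by
  rintro ⟨p, hp, a, ha, b, hb, hφ, hdiv⟩
  have hk := two_le_of_holds hp hφ
  obtain ⟨hXi, u, V, hV, hψ⟩ := hp
  obtain ⟨huV, hu⟩ := hdiv.notMem_acl hV hψ hk
  have hsub : C ∪ entriesNe b u ⊆ B ∪ C := by
    rintro e (he | ⟨y, -, rfl⟩)
    · exact Or.inr he
    · exact hb y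
  -- The criterion is applied with `D` equal to `C` and the entries of `b` other than `b_u`. The
  -- entry `b_u` lies in `B`, since elements of `C` are algebraic over `D`.
  refine hu (h _ Set.subset_union_left hsub ⟨?_, (hb u).resolve_right fun hC =>
    hu (subset_acl _ (Or.inl hC))⟩)
  obtain ⟨Q, hQ, e⟩ := (Formula.def (M := M) p.φ).exists_split u
  refine mem_acl_of_tuple (c := join a fun y : {y // y ≠ u} => b y) ?_ hQ ?_ ?_
  · rintro (x | y)
    · exact Or.inl (ha x)
    · exact Or.inr (Or.inr ⟨y, y.2, rfl⟩)
  · simp only [e, Function.update_eq_self]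
    exact hφ
  -- `k` distinct solutions in `u`, with the other entries fixed, would satisfy `ψ` and violate
  -- inconsistency.
  · refine finite_of_forall_not_injective (k := p.k) fun x hx hall => hXi ⟨a,
      fun i => Function.update b u (x i), fun i => (e _ _ _).1 (hall i),
      (hψ fun i => Function.update b u (x i)).2 fun i j hij => ⟨?_, fun v hv => ?_⟩⟩
    · simp only [Function.update_self]
      exact hx.ne hij.ne
    · have hvu : v ≠ u := fun h => huV (h ▸ hv)
      simp only [Function.update_of_ne hvu]

open Classical in
theorem OmegaIndep.acl_inter_subset {κ : Cardinal.{u}} (hM : IsBigModel M κ)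
    {A B C D : Set (Elem M)} (hC : IsSmall κ C) (h : OmegaIndep (XiM M) A C B) (hCD : C ⊆ D)
    (hD : D ⊆ B ∪ C) : acl (A ∪ D) ∩ B ⊆ acl D := by
  rintro e ⟨he, heB⟩
  by_contra heD
  obtain ⟨n, τ, c, hc, Q, hQ, hQc, k, hk⟩ := exists_uniform_of_mem_acl he
  -- The parameters of the algebraic formula are split: those in `A` become `x̄`, the others, which
  -- lie in `D`, become `v̄`, and `u` stands for `e`.
  let X := {j : Fin n // (⟨τ j, c j⟩ : Elem M) ∈ A}
  let Y := Unit ⊕ {j : Fin n // (⟨τ j, c j⟩ : Elem M) ∉ A}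
  let sx : X → L.Sorts := fun j => τ j
  let sy : Y → L.Sorts := Sum.elim (fun _ => e.1) fun j => τ j
  let f : Unit ⊕ Fin n → X ⊕ Y :=
    Sum.elim (fun _ => .inr (.inl ()))
      fun j => if h : (⟨τ j, c j⟩ : Elem M) ∈ A then .inl ⟨j, h⟩ else .inr (.inr ⟨j, h⟩)
  have hfA : ∀ j (h : (⟨τ j, c j⟩ : Elem M) ∈ A), f (.inr j) = .inl ⟨j, h⟩ := fun j h => by
    simp [f, h]
  have hfA' : ∀ j (h : (⟨τ j, c j⟩ : Elem M) ∉ A), f (.inr j) = .inr (.inr ⟨j, h⟩) :=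
    fun j h => by simp [f, h]
  have hf : ∀ z, Sum.elim sx sy (f z) = Sum.elim (fun _ => e.1) τ z := by
    rintro (_ | j)
    · rfl
    · by_cases h : (⟨τ j, c j⟩ : Elem M) ∈ A
      · rw [hfA j h]; rfl
      · rw [hfA' j h]; rfl
  have hpull : ∀ (a : ∀ i, M (sx i)) (b : ∀ y, M (sy y)) (y : ∀ j, M (τ j)),
      (∀ j : X, a j = y j) → (∀ j : {j : Fin n // (⟨τ j, c j⟩ : Elem M) ∉ A}, b (.inr j) = y j) →
      pull f hf (join a b) = join (fun _ => b (.inl ())) y := by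
    intro a b y ha hb
    funext z
    have h₁ := pull_spec f hf (join a b) z
    have key : ∀ d, f z = d → (⟨Sum.elim sx sy d, join a b d⟩ : Elem M) =
        ⟨Sum.elim (fun _ => e.1) τ z, join (fun _ => b (.inl ())) y z⟩ := by
      rintro d rfl
      rcases z with _ | j
      · rfl
      · by_cases h : (⟨τ j, c j⟩ : Elem M) ∈ A
        · rw [hfA j h]
          exact congrArg (Sigma.mk (τ j)) (ha ⟨j, h⟩)
        · rw [hfA' j h]
          exact congrArg (Sigma.mk (τ j)) (hb ⟨j, h⟩)
    exact eq_of_heq (Sigma.mk.inj (h₁.symm.trans (key _ rfl))).2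
  obtain ⟨φ, hφ⟩ := hQ.pull f hf
  have hφQ : ∀ (a : ∀ i, M (sx i)) (b : ∀ y, M (sy y)) (y : ∀ j, M (τ j)),
      (∀ j : X, a j = y j) → (∀ j : {j : Fin n // (⟨τ j, c j⟩ : Elem M) ∉ A}, b (.inr j) = y j) →
      (φ.Holds (join a b) ↔ Q (join (fun _ => b (.inl ())) y)) := fun a b y ha hb =>
    (hφ _).trans (iff_of_eq (congrArg Q (hpull a b y ha hb)))
  have hψ : Def (M := M) (fun q : Fin k × Y => sy q.2) fun z =>
      ∀ i : {i : Fin k × Fin k // i.1 < i.2},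
        ¬ ((⟨sy (.inl ()), z (i.1.1, .inl ())⟩ : Elem M) = ⟨sy (.inl ()), z (i.1.2, .inl ())⟩) ∧
        ∀ j : {j : Fin n // (⟨τ j, c j⟩ : Elem M) ∉ A},
          (⟨sy (.inr j), z (i.1.1, .inr j)⟩ : Elem M) = ⟨sy (.inr j), z (i.1.2, .inr j)⟩ :=
    Def.forall_finite fun i =>
      (Def.eq_var (σ := fun q : Fin k × Y => sy q.2) (i.1.1, .inl ()) (i.1.2, .inl ())).not.and
        (Def.forall_finite fun j =>
          Def.eq_var (σ := fun q : Fin k × Y => sy q.2) (i.1.1, .inr j) (i.1.2, .inr j))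
  obtain ⟨ψ, hψ⟩ := hψ
  let p : FormulaPair L := ⟨X, Y, inferInstance, inferInstance, sx, sy, k, φ, ψ⟩
  have hpψ : ∀ b : Fin p.k → ∀ y, M (p.sy y), p.ψ.Holds (fun q => b q.1 q.2) ↔
      ∀ i j, i < j → b i (.inl ()) ≠ b j (.inl ()) ∧
        ∀ v ∈ Set.range (Sum.inr : _ → Y), b i v = b j v := by
    intro b
    refine (hψ _).trans ⟨fun h i j hij => ?_, fun h i => ?_⟩
    · obtain ⟨h₁, h₂⟩ := h ⟨(i, j), hij⟩
      refine ⟨fun e => h₁ (congrArg (Sigma.mk _) e), ?_⟩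
      rintro _ ⟨v, rfl⟩
      exact eq_of_heq (Sigma.mk.inj (h₂ v)).2
    · obtain ⟨h₁, h₂⟩ := h _ _ i.2
      exact ⟨fun e => h₁ (eq_of_heq (Sigma.mk.inj e).2),
        fun j => congrArg (Sigma.mk _) (h₂ _ ⟨j, rfl⟩)⟩
  have hXi : p ∈ Xi M := by
    rintro ⟨a, b, hab, hb⟩
    have hb := (hpψ b).1 hb
    -- For `k = 0` the uniform bound would be refuted by the empty family.
    have hk₀ : 0 < k := Nat.pos_of_ne_zero fun h₀ => by
      subst h₀
      exact hk c (fun i => i.elim0) (fun i => i.elim0) fun i => i.elim0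
    have hconst : ∀ (i : Fin k) v, b i (.inr v) = b ⟨0, hk₀⟩ (.inr v) := fun i v => by
      rcases Nat.eq_zero_or_pos i.1 with h | h
      · have : i = ⟨0, hk₀⟩ := Fin.ext h
        rw [this]
      · exact ((hb ⟨0, hk₀⟩ i h).2 _ ⟨v, rfl⟩).symm
    -- The parameters are `a` on the `A`-part and the common value of the copies of `v̄` elsewhere;
    -- the copies of `u` are then `k` distinct solutions.
    refine hk (fun j => if h : (⟨τ j, c j⟩ : Elem M) ∈ A then a ⟨j, h⟩ else
      b ⟨0, hk₀⟩ (.inr ⟨j, h⟩)) (fun i => b i (.inl ())) (fun i j hij => ?_) fun i => ?_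
    · by_contra hne
      rcases lt_or_gt_of_ne hne with h | h
      · exact (hb _ _ h).1 hij
      · exact (hb _ _ h).1 hij.symm
    · refine (hφQ a (b i) _ ?_ ?_).1 (hab i)
      · exact fun ⟨j, h⟩ => by simp [h]
      · exact fun j => by simp [j.2, hconst]
  have hmem : p ∈ XiM M := ⟨hXi, .inl (), Set.range .inr, by
    rintro (_ | j)
    · exact Or.inl rfl
    · exact Or.inr ⟨j, rfl⟩, hpψ⟩
  have hcD : ∀ j : {j : Fin n // (⟨τ j, c j⟩ : Elem M) ∉ A}, (⟨τ j, c j⟩ : Elem M) ∈ D :=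
    fun j => (hc j).resolve_left j.2
  refine h ⟨p, hmem, fun j => c j, fun j => j.2, join (fun _ => e.2) fun j => c j, ?_, ?_, ?_⟩
  · rintro (_ | j)
    · exact Or.inl heB
    · exact hD (hcD j)
  · exact (hφQ (fun j => c j) (join (fun _ => e.2) fun j => c j) c (fun _ => rfl)
      fun _ => rfl).2 hQc
  · refine formulaDivides_of_notMem_acl hM hXi hpψ (by simp) hC fun hacl => heD ?_
    refine acl_mono ?_ hacl
    rintro _ (h | ⟨_ | j, hj, rfl⟩)
    · exact hCD h
    · exact absurd rfl hj
    · exact hcD j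

theorem omegaIndep_xiM_iff {κ : Cardinal.{u}} (hM : IsBigModel M κ) {A B C : Set (Elem M)}
    (hC : IsSmall κ C) : OmegaIndep (XiM M) A C B ↔
      ∀ D, C ⊆ D → D ⊆ B ∪ C → acl (A ∪ D) ∩ B ⊆ acl D :=
  ⟨fun h _ hCD hD => h.acl_inter_subset hM hC hCD hD, omegaIndep_xiM_of_acl⟩

/-! ### Comparison of M-dividing, `Ξ_M`-dividing and their star versions -/

theorem MIndep.omegaIndep_xiM {A B C : Set (Elem M)} (h : MIndep A C B) :
    OmegaIndep (XiM M) A C B :=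
  omegaIndep_xiM_of_acl fun D hCD hD _ he =>
    (h D hCD (hD.trans (subset_acl _))).subset ⟨he.1, subset_acl _ (Or.inl he.2)⟩

/-- M-independence concerns sets `C'` and elements inside `acl(BC)`, so the criterion is used with
`acl(BC)` on the right. -/
theorem OmegaIndep.mIndep {κ : Cardinal.{u}} (hM : IsBigModel M κ) {A B C : Set (Elem M)}
    (hC : IsSmall κ C) (h : OmegaIndep (XiM M) A C (acl (B ∪ C))) : MIndep A C B := by
  intro C' hCC' hC'
  refine Set.Subset.antisymm (fun e he => ?_) fun e he =>
    ⟨acl_mono Set.subset_union_right he, acl_mono Set.subset_union_right he⟩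
  refine h.acl_inter_subset hM hC hCC' (hC'.trans Set.subset_union_left) ⟨he.1, ?_⟩
  refine acl_subset_acl ?_ he.2
  exact Set.union_subset (Set.subset_union_left.trans (subset_acl _)) hC'

theorem starIndep_mIndep_iff {κ : Cardinal.{u}} (hM : IsBigModel M κ) {A B C : Set (Elem M)}
    (hC : IsSmall κ C) :
    StarIndep κ MIndep A C B ↔ StarIndep κ (OmegaIndep (XiM M)) A C B := by
  constructor
  · intro h B' hB' hBB'
    obtain ⟨A', hA', hind⟩ := h B' hB' hBB'
    exact ⟨A', hA', hind.omegaIndep_xiM⟩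
  · intro h B' hB' hBB'
    have hs : IsSmall κ (B' ∪ C) :=
      (mk_union_le _ _).trans_lt (add_lt_of_lt hM.aleph0_lt.le hB' hC)
    obtain ⟨A', hA', hind⟩ := h (acl (B' ∪ C)) (isSmall_acl hM.aleph0_lt hM.card_lt hs)
      (hBB'.trans (Set.subset_union_left.trans (subset_acl _)))
    -- The extension was tested on the small set `acl(B'C)` instead of `B'`.
    exact ⟨A', hA', hind.mIndep hM hC⟩

/-! ### Closure properties of `Ξ_M` -/

theorem closedUnderSubst_xiM : ClosedUnderSubst (XiM M) := by
  rintro p ⟨hXi, u, V, hV, hψ⟩ U W finU finW su sv f g hf hg - hgs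
  have hpsi : ∀ b : Fin p.k → ∀ y, M (sv y),
      Formula.Holds (BFormula.relabel (τ := fun q : Fin p.k × W => sv q.2)
        (fun q : Fin p.k × p.Y => (q.1, g q.2)) (fun q => hg q.2) p.ψ) (fun q => b q.1 q.2) ↔
      p.ψ.Holds fun q => pull g hg (b q.1) q.2 := fun b =>
    Formula.holds_relabel _ _ _ _ (fun q => pull_spec g hg (b q.1) q.2) _
  refine ⟨?_, g u, g '' V, fun y => ?_, fun b => ?_⟩
  · rintro ⟨a, b, hφ, hb⟩
    refine hXi ⟨pull f hf a, fun i => pull g hg (b i), fun i => ?_, (hpsi b).1 hb⟩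
    refine (Formula.holds_relabel _ _ _ _ ?_ _).1 (hφ i)
    rintro (x | y)
    · exact pull_spec f hf a x
    · exact pull_spec g hg (b i) y
  · obtain ⟨y, rfl⟩ := hgs y
    exact (hV y).imp (congrArg g) fun h => ⟨y, h, rfl⟩
  · refine (hpsi b).trans ((hψ fun i => pull g hg (b i)).trans ?_)
    -- Pulling back is a cast, hence reflects equality. This covers also the case where `g`
    -- identifies `u` with a variable in `V`.
    have hinj : ∀ i j y, pull g hg (b i) y = pull g hg (b j) y ↔ b i (g y) = b j (g y) :=
      fun i j y => cast_inj _
    simp only [ne_eq, hinj, Set.forall_mem_image]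

theorem isTransitive_xiM {κ : Cardinal.{u}} (hM : IsBigModel M κ) :
    IsTransitive M κ (XiM M) := by
  rintro p ⟨hXi, u, V, hV, hψ⟩ C D a hC hDC hind hdiv
  rcases lt_or_ge p.k 2 with hk | hk
  -- With `k < 2` the condition `ψ` is vacuous and the constant sequence serves over any base.
  · refine ⟨hXi, fun _ => a, fun _ _ h => h, fun f _ => (hψ fun _ => a).2 fun i j hij => ?_⟩
    have : i.1 < j.1 := hij
    omega
  · obtain ⟨huV, hu⟩ := hdiv.notMem_acl hV hψ hk
    refine formulaDivides_of_notMem_acl hM hXi hψ huV hC fun hacl => hu ?_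
    have hD : IsSmall κ D := (mk_le_mk_of_subset hDC).trans_lt hC
    -- If `a_u` were algebraic over `C` and the other entries, independence of `C` from `a` would
    -- make it algebraic over `D` and those entries.
    refine hind.acl_inter_subset hM hD Set.subset_union_left ?_
      ⟨acl_mono (Set.union_subset_union_right C Set.subset_union_right) hacl, u, rfl⟩
    rintro e (he | ⟨y, -, rfl⟩)
    · exact Or.inr he
    · exact Or.inl ⟨y, rfl⟩

theorem normalWitness_holds {Z Y : Type} [Finite Z] {sz : Z → L.Sorts} {sy : Y → L.Sorts} {k : ℕ}
    {ψ : L.Formula (fun q : Fin k × Y => sy q.2)}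
    (b : Fin k → ∀ y, M (Sum.elim sz sy y)) :
    (normalWitness sz sy k ψ).Holds (fun q => b q.1 q.2) ↔
      ψ.Holds (fun q => b q.1 (.inr q.2)) ∧ ∀ z i j, b i (.inl z) = b j (.inl z) := by
  refine (BFormula.realize_and _ _ _ _).trans (and_congr ?_ ?_)
  · exact Formula.holds_relabel (M := M) (τ := fun q : Fin k × (Z ⊕ Y) => Sum.elim sz sy q.2)
      (fun q : Fin k × Y => (q.1, Sum.inr q.2)) (elim_inr sz sy k) (fun q => b q.1 q.2) _
      (fun _ => rfl) ψ
  · refine (BFormula.realize_conj _ _ _).trans ?_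
    exact ⟨fun h z i j => h (z, i, j), fun h t => h t.1 t.2.1 t.2.2⟩

theorem isNormal_xiM (hne : ∀ s, Nonempty (M s)) : IsNormal (XiM (L := L) M) := by
  rintro X Z Y finX finZ finY sx sz sy k φ ψ ⟨hXi, u, V, hV, hψ⟩
  refine ⟨?_, .inr u, Set.range .inl ∪ Sum.inr '' V, ?_, fun b => ?_⟩
  · rintro ⟨a, b, hφ, hb⟩
    obtain ⟨hb₁, hb₂⟩ := (normalWitness_holds b).1 hb
    -- The common value of the copies of `z̄`; for `k = 0` there are no copies, and non-emptiness of
    -- the sorts supplies an arbitrary tuple.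
    obtain ⟨c, hc⟩ : ∃ c : ∀ z, M (sz z), ∀ i z, b i (.inl z) = c z := by
      rcases k.eq_zero_or_pos with rfl | hk
      · exact ⟨fun z => (hne _).some, fun i => i.elim0⟩
      · exact ⟨fun z => b ⟨0, hk⟩ (.inl z), fun i z => hb₂ z _ _⟩
    refine hXi ⟨join a c, fun i y => b i (.inr y), fun i => ?_, hb₁⟩
    refine (Formula.holds_relabel _ _ _ _ ?_ _).1 (hφ i)
    rintro ((x | z) | y)
    · rfl
    · exact congrArg (Sigma.mk (sz z)) (hc i z)
    · rfl
  · rintro (z | y)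
    · exact Or.inr (Or.inl ⟨z, rfl⟩)
    · exact (hV y).imp (congrArg _) fun h => Or.inr ⟨y, h, rfl⟩
  · refine (normalWitness_holds b).trans ((and_congr_left' (hψ fun i y => b i (.inr y))).trans ?_)
    constructor
    · rintro ⟨h₁, h₂⟩ i j hij
      refine ⟨(h₁ i j hij).1, ?_⟩
      rintro _ (⟨z, rfl⟩ | ⟨y, hy, rfl⟩)
      · exact h₂ z i j
      · exact (h₁ i j hij).2 y hy
    · intro h
      refine ⟨fun i j hij => ⟨(h i j hij).1, fun v hv => (h i j hij).2 _ (Or.inr ⟨v, hv, rfl⟩)⟩,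
        fun z i j => ?_⟩
      rcases lt_trichotomy i j with hij | rfl | hij
      · exact (h i j hij).2 _ (Or.inl ⟨z, rfl⟩)
      · rfl
      · exact ((h j i hij).2 _ (Or.inl ⟨z, rfl⟩)).symm

end SortedLanguage

theorem mainTheorem6 (L : SortedLanguage.{u}) (M : L.Sorts → Type u) [L.Structure M]
    (κ : Cardinal.{u}) (hM : IsBigModel M κ) :
    (∀ A B C : Set (Elem M), IsSmall κ A → IsSmall κ B → IsSmall κ C →
      (OmegaIndep (XiM M) A C B ↔
        ∀ D, C ⊆ D → D ⊆ B ∪ C → acl (A ∪ D) ∩ B ⊆ acl D)) ∧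
    (ClosedUnderSubst (XiM M) ∧ IsTransitive M κ (XiM M) ∧ IsNormal (XiM M)) ∧
    (∀ A B C : Set (Elem M), IsSmall κ A → IsSmall κ B → IsSmall κ C →
      MIndep A C B → OmegaIndep (XiM M) A C B) ∧
    (∀ A B C : Set (Elem M), IsSmall κ A → IsSmall κ B → IsSmall κ C →
      (ThornIndep κ A C B ↔ StarIndep κ MIndep A C B) ∧
      (ThornIndep κ A C B ↔ StarIndep κ (OmegaIndep (XiM M)) A C B)) := by
  refine ⟨fun A B C _ _ hC => omegaIndep_xiM_iff hM hC,
    ⟨closedUnderSubst_xiM, isTransitive_xiM hM, isNormal_xiM hM.nonempty⟩,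
    fun A B C _ _ _ h => h.omegaIndep_xiM,
    -- Thorn-independence is by definition the star of M-independence.
    fun A B C _ _ hC => ⟨Iff.rfl, starIndep_mIndep_iff hM hC⟩⟩
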